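/- Let $r,r'\ge 1$, let $A\in\mathbb{R}^{r\times r}$, $C\in\mathbb{R}^{r'\times r}$, let $R\in\mathbb{R}^{r\times r}$ and $\Sigma\in\mathbb{R}^{r'\times r'}$ be symmetric positive definite, put $S:=C'\Sigma^{-1}C$ (where $'$ is transposition), and assume that $(A,C)$ is observable, i.e. the stacked matrix with blocks $C,CA,\dots,CA^{r-1}$ has rank $r$. Let $\mathbb{S}_r^+$ be the set of symmetric positive semidefinite $r\times r$ matrices and $\|\cdot\|_2$ the spectral norm. Let $\phi_t(Q)$, $t\ge 0$, $Q\in\mathbb{S}_r^+$, be the $\mathbb{S}_r^+$-valued semigroup of the Riccati equation $\partial_tP_t=AP_t+P_tA'-P_tSP_t+R$, $P_0=Q$. For $\epsilon=(\epsilon_1,\epsilon_2)\in[0,1]^2$ let $\phi_{\epsilon,t}(Q)$ be the $\mathbb{S}_r^+$-valued semigroup of the mean-repulsion covariance equation $$\partial_tP_t=[A-P_tS(\mathrm{Id}+T_2)-T_1(P_t)]P_t+P_t[A-P_tS(\mathrm{Id}+T_2)-T_1(P_t)]'+R+P_tSP_t$$ with $T_1(Q)=\epsilon_1QS$ and $T_2=\epsilon_2\mathrm{Id}$;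 on $\mathbb{S}_r^+$ this is the equation $\partial_tP_t=AP_t+P_tA'-P_tS_\epsilon P_t+R$ with $S_\epsilon=(1+2(\epsilon_1+\epsilon_2))S$. These semigroups are well defined for all $t\ge 0$ (global existence and uniqueness in $\mathbb{S}_r^+$). Each of them has exactly one fixed point in $\mathbb{S}_r^+$, denoted $P=\phi_t(P)$ and $P_\epsilon=\phi_{\epsilon,t}(P_\epsilon)$ (for all $t\geq 0$); it is positive definite and is a zero of the drift of its equation. Let $E_t(Q)$ be the solution of $\partial_tE_t(Q)=(A-\phi_t(Q)S)E_t(Q)$, $E_0(Q)=\mathrm{Id}$. Call $\nu>0$ a contraction rate if there are finite non-decreasing functions $\kappa_E(q_1)$, $\kappa_\phi(q_1,q_2)$, $\kappa_E(q_1,q_2)$ such that for all $Q_1,Q_2\in\mathbb{S}_r^+$ and $t\ge0$ $$\|E_t(Q_1)\|_2\le\kappa_E(\|Q_1\|_2)e^{-2\nu t},\qquad \|\phi_t(Q_2)-\phi_t(Q_1)\|_2\le\kappa_\phi(\|Q_1\|_2,\|Q_2\|_2)e^{-2\nu t}\|Q_2-Q_1\|_2,$$ $$\|E_t(Q_2)-E_t(Q_1)\|_2\le\kappa_E(\|Q_1\|_2,\|Q_2\|_2)e^{-\nu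 t}\|Q_2-Q_1\|_2 .$$ Then contraction rates exist, and for every contraction rate $\nu$ there are $\delta\in(0,1]$, a finite constant $\chi_1(\delta)$ and a finite function $q\mapsto\chi_2(\delta,q)$ such that for all $\epsilon\in[0,\delta]^2$, all $t\ge 0$ and all $Q\in\mathbb{S}_r^+$ $$\|\phi_{\epsilon,t}(Q)-\phi_t(Q)\|_2\le 2(\epsilon_1+\epsilon_2)\,\bigl[\chi_1(\delta)+e^{-4t\nu}\chi_2(\delta,\|Q\|_2)\bigr],$$ and for all $\epsilon\in[0,\delta]^2$ $$\|P_\epsilon-P\|_2\le 2(\epsilon_1+\epsilon_2)\,\chi_1(\delta).$$ The constants may depend on the fixed data $(A,R,S)$ and on $\nu$, but not on $\epsilon$, $t$, or (except through $\|Q\|_2$ in $\chi_2$) on $Q$. -/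

import Mathlib

/- The norm on square matrices is the spectral norm, i.e. the operator norm for the Euclidean norm. -/
open scoped Matrix.Norms.L2Operator

noncomputable section

namespace KalmanRiccati

/-- The matrix obtained by stacking the blocks `C, C A, …, C A^(r-1)`. -/
def observabilityMatrix {r r' : ℕ} (A : Matrix (Fin r) (Fin r) ℝ) (C : Matrix (Fin r') (Fin r) ℝ) :
    Matrix (Fin r × Fin r') (Fin r) ℝ :=
  Matrix.of fun p j => (C * A ^ (p.1 : ℕ)) p.2 j

/-- Observability of the pair `(A, C)`, by the rank condition. -/
def IsObservable {r r' : ℕ} (A : Matrix (Fin r) (Fin r) ℝ) (C : Matrix (Fin r') (Fin r) ℝ) : Prop :=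
  (observabilityMatrix A C).rank = r

/-- The Riccati drift `Q ↦ A Q + Q A' - Q S Q + R`. -/
def riccatiDrift {r : ℕ} (A R S : Matrix (Fin r) (Fin r) ℝ) (Q : Matrix (Fin r) (Fin r) ℝ) :
    Matrix (Fin r) (Fin r) ℝ :=
  A * Q + Q * A.transpose - Q * S * Q + R

/-- The drift of the covariance equation of a mean-repulsion diffusion with repulsion terms
`T₁ : 𝕊⁺ → 𝕄` and `T₂`. -/
def meanRepulsionDrift {r : ℕ} (A R S : Matrix (Fin r) (Fin r) ℝ)
    (T₁ : Matrix (Fin r) (Fin r) ℝ → Matrix (Fin r) (Fin r) ℝ) (T₂ : Matrix (Fin r) (Fin r) ℝ)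
    (Q : Matrix (Fin r) (Fin r) ℝ) : Matrix (Fin r) (Fin r) ℝ :=
  (A - Q * S * (1 + T₂) - T₁ Q) * Q + Q * (A - Q * S * (1 + T₂) - T₁ Q).transpose + R + Q * S * Q

/-- The mean-repulsion drift for the choice `T₁(Q) = ε₁ Q S` and `T₂ = ε₂ Id`. -/
def perturbedDrift {r : ℕ} (A R S : Matrix (Fin r) (Fin r) ℝ) (ε₁ ε₂ : ℝ) :
    Matrix (Fin r) (Fin r) ℝ → Matrix (Fin r) (Fin r) ℝ :=
  meanRepulsionDrift A R S (fun Q => ε₁ • (Q * S)) (ε₂ • 1)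

/-- On symmetric matrices the perturbed drift is the Riccati drift in which `S` is replaced by
`(1 + 2 (ε₁ + ε₂)) S`. -/
theorem perturbedDrift_eq {r : ℕ} (A R S : Matrix (Fin r) (Fin r) ℝ) (ε₁ ε₂ : ℝ)
    (hS : S.IsSymm) (Q : Matrix (Fin r) (Fin r) ℝ) (hQ : Q.IsSymm) :
    perturbedDrift A R S ε₁ ε₂ Q = riccatiDrift A R ((1 + 2 * (ε₁ + ε₂)) • S) Q := by
  have hS' : S.transpose = S := hS
  have hQ' : Q.transpose = Q := hQ
  simp only [perturbedDrift, meanRepulsionDrift, riccatiDrift, Matrix.transpose_sub,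
    Matrix.transpose_mul, Matrix.transpose_add, Matrix.transpose_smul, hS',
    hQ', mul_add, add_mul, sub_mul, mul_sub, mul_one, Matrix.smul_mul, Matrix.mul_smul,
    Matrix.mul_assoc]
  module

/-- `P` solves `∂ₜ Pₜ = F(Pₜ)`, `P₀ = Q` on `[0, ∞)` in the cone of positive semidefinite matrices
(the values of `P` at negative times are irrelevant). -/
structure IsCovarianceSolution {r : ℕ} (F : Matrix (Fin r) (Fin r) ℝ → Matrix (Fin r) (Fin r) ℝ)
    (Q : Matrix (Fin r) (Fin r) ℝ) (P : ℝ → Matrix (Fin r) (Fin r) ℝ) : Prop where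
  init : P 0 = Q
  posSemidef : ∀ t, 0 ≤ t → (P t).PosSemidef
  deriv : ∀ t, 0 ≤ t → HasDerivWithinAt P (F (P t)) (Set.Ici 0) t

/-- Global existence and uniqueness on `[0, ∞)`, from every positive semidefinite initial value. -/
def IsWellPosed {r : ℕ} (F : Matrix (Fin r) (Fin r) ℝ → Matrix (Fin r) (Fin r) ℝ) : Prop :=
  ∀ Q : Matrix (Fin r) (Fin r) ℝ, Q.PosSemidef →
    ∃ P, IsCovarianceSolution F Q P ∧
      ∀ P', IsCovarianceSolution F Q P' → ∀ t, 0 ≤ t → P' t = P t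

open Classical in
/-- The semigroup `flow F t Q` of the equation `∂ₜ Pₜ = F(Pₜ)`: the value at time `t ≥ 0` of the
solution that starts at `Q` (with value `0` if there is no solution). -/
def flow {r : ℕ} (F : Matrix (Fin r) (Fin r) ℝ → Matrix (Fin r) (Fin r) ℝ) (t : ℝ)
    (Q : Matrix (Fin r) (Fin r) ℝ) : Matrix (Fin r) (Fin r) ℝ :=
  if h : ∃ P, IsCovarianceSolution F Q P then h.choose t else 0

/-- `P` is a fixed point of the semigroup in the cone of positive semidefinite matrices. -/
def IsFixedPoint {r : ℕ} (F : Matrix (Fin r) (Fin r) ℝ → Matrix (Fin r) (Fin r) ℝ)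
    (P : Matrix (Fin r) (Fin r) ℝ) : Prop :=
  P.PosSemidef ∧ ∀ t, 0 ≤ t → flow F t P = P

/-- The semigroup has exactly one fixed point; it is positive definite and a zero of the drift. -/
def HasUniqueFixedPoint {r : ℕ} (F : Matrix (Fin r) (Fin r) ℝ → Matrix (Fin r) (Fin r) ℝ) : Prop :=
  ∃ P : Matrix (Fin r) (Fin r) ℝ, P.PosDef ∧ F P = 0 ∧ ∀ P', IsFixedPoint F P' ↔ P' = P

/-- `E` is the transition matrix on `[0, ∞)` of the time-dependent matrices `A - φₜ(Q) S`, where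
`φ` is the Riccati semigroup of `(A, R, S)`. -/
structure IsTransitionMatrix {r : ℕ} (A R S Q : Matrix (Fin r) (Fin r) ℝ)
    (E : ℝ → Matrix (Fin r) (Fin r) ℝ) : Prop where
  init : E 0 = 1
  deriv : ∀ t, 0 ≤ t →
    HasDerivWithinAt E ((A - flow (riccatiDrift A R S) t Q * S) * E t) (Set.Ici 0) t

/-- `ν` is a contraction rate of the Riccati semigroup of `(A, R, S)` and of its transition
matrices `E Q`: the three local contraction inequalities hold with some non-decreasing functions
of the norms of the initial values. -/
def IsContractionRate {r : ℕ} (A R S : Matrix (Fin r) (Fin r) ℝ) (ν : ℝ) : Prop :=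
  0 < ν ∧ ∃ E : Matrix (Fin r) (Fin r) ℝ → ℝ → Matrix (Fin r) (Fin r) ℝ,
    (∀ Q : Matrix (Fin r) (Fin r) ℝ, Q.PosSemidef → IsTransitionMatrix A R S Q (E Q)) ∧
    ∃ (κE : ℝ → ℝ) (κφ κE₂ : ℝ × ℝ → ℝ), Monotone κE ∧ Monotone κφ ∧ Monotone κE₂ ∧
      (∀ Q : Matrix (Fin r) (Fin r) ℝ, Q.PosSemidef → ∀ t, 0 ≤ t →
        ‖E Q t‖ ≤ κE ‖Q‖ * Real.exp (-(2 * ν * t))) ∧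
      (∀ Q₁ Q₂ : Matrix (Fin r) (Fin r) ℝ, Q₁.PosSemidef → Q₂.PosSemidef → ∀ t, 0 ≤ t →
        ‖flow (riccatiDrift A R S) t Q₂ - flow (riccatiDrift A R S) t Q₁‖
          ≤ κφ (‖Q₁‖, ‖Q₂‖) * Real.exp (-(2 * ν * t)) * ‖Q₂ - Q₁‖) ∧
      (∀ Q₁ Q₂ : Matrix (Fin r) (Fin r) ℝ, Q₁.PosSemidef → Q₂.PosSemidef → ∀ t, 0 ≤ t →
        ‖E Q₂ t - E Q₁ t‖ ≤ κE₂ (‖Q₁‖, ‖Q₂‖) * Real.exp (-(ν * t)) * ‖Q₂ - Q₁‖)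

end KalmanRiccati

end

open KalmanRiccati

/-!
The Riccati flow is given here in closed form around its stationary point, and the perturbation
estimate is a comparison of two such flows.

*Stationary point.* For stable `B` (one with a positive definite `X` such that `B X + X B' < 0`) the
Lyapunov equation `B Z + Z B' = M` is solvable and reverses signs
(`LyapunovStable.exists_solution`, `LyapunovStable.posSemidef`). By observability, the inverse of
the Gramian of a shift of `A`, suitably scaled, is a supersolution of the algebraic Riccati
equation. A Newton step leads from a supersolution to a smaller one, so a supersolution of minimal
trace is a solution `P`; it is positive definite and `B = A - P S` is stable
(`RiccatiData.exists_steadyState`).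

*Closed form.* With `E(t) = exp (t B)`, `Γ` the Gramian of `B`, `G(t) = Γ - E(t)' Γ E(t)` and
`Δ = Q - P`, the Riccati flow from `Q` is `P + E (1 + Δ G)⁻¹ Δ E'` and its transition matrix is
`E (1 + Δ G)⁻¹`. The gap `Γ < P⁻¹` bounds `G (1 + Δ G)⁻¹` uniformly in `Q ≥ 0` and `t ≥ 0`
(`SteadyState.gram_mulVec_le`). This yields global existence, the contraction inequalities through
the exact difference formulas `SteadyState.sol_sub_sol` and `SteadyState.trans_sub_trans`, and
convergence to `P`. Since `(1 + Δ G)⁻¹ Δ = G⁻¹ (G - G (1 + Δ G)⁻¹) G⁻¹` and `G(t) → Γ > 0`, the flow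
is bounded at large times uniformly in the initial value (`SteadyState.exists_uniform_bound`).

*Perturbation.* Let `φ` and `ψ` be the flows for `S` and `(1 + η) S`, where `η = 2 (ε₁ + ε₂)`. Then
`ψ ≤ φ`, and `(1 + η) ψ` solves the Riccati equation for `S` with `R` replaced by the larger
`(1 + η) R`, whence `φ ≤ (1 + η) ψ`. So `0 ≤ φ - ψ ≤ η ψ ≤ η φ` and `‖ψ - φ‖ ≤ η ‖φ‖`
(`SteadyState.norm_sol_sub_sol_le`). Past a time `t₀` the norm `‖φ‖` is at most a constant `χ₁`
independent of `Q`; before `t₀` a bound in terms of `‖Q‖`, multiplied by `exp (4 t₀ ν)`, serves as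
`χ₂`. Hence `δ = 1` works for every rate `ν > 0`.
-/

namespace KalmanRiccati

open scoped Matrix.Norms.L2Operator
open scoped Matrix
open Matrix

/-! ### Quadratic forms and the spectral norm -/

theorem posSemidef_iff_dotProduct {n : ℕ} {M : Matrix (Fin n) (Fin n) ℝ} :
    M.PosSemidef ↔ Mᵀ = M ∧ ∀ v : Fin n → ℝ, 0 ≤ v ⬝ᵥ M *ᵥ v := by
  rw [Matrix.posSemidef_iff_dotProduct_mulVec]
  simp [Matrix.IsHermitian, Matrix.conjTranspose_eq_transpose_of_trivial]

theorem posDef_iff_dotProduct {n : ℕ} {M : Matrix (Fin n) (Fin n) ℝ} :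
    M.PosDef ↔ Mᵀ = M ∧ ∀ v : Fin n → ℝ, v ≠ 0 → 0 < v ⬝ᵥ M *ᵥ v := by
  rw [Matrix.posDef_iff_dotProduct_mulVec]
  simp [Matrix.IsHermitian, Matrix.conjTranspose_eq_transpose_of_trivial]

theorem _root_.Matrix.PosSemidef.transpose_eq {n : ℕ} {M : Matrix (Fin n) (Fin n) ℝ}
    (h : M.PosSemidef) : Mᵀ = M := (posSemidef_iff_dotProduct.1 h).1

theorem _root_.Matrix.PosSemidef.quad_nonneg {n : ℕ} {M : Matrix (Fin n) (Fin n) ℝ}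
    (h : M.PosSemidef) (v : Fin n → ℝ) : 0 ≤ v ⬝ᵥ M *ᵥ v := (posSemidef_iff_dotProduct.1 h).2 v

theorem _root_.Matrix.PosDef.quad_pos {n : ℕ} {M : Matrix (Fin n) (Fin n) ℝ}
    (h : M.PosDef) {v : Fin n → ℝ} (hv : v ≠ 0) : 0 < v ⬝ᵥ M *ᵥ v :=
  (posDef_iff_dotProduct.1 h).2 v hv

theorem dotProduct_self_nonneg {n : ℕ} (v : Fin n → ℝ) : 0 ≤ v ⬝ᵥ v := by
  simpa using Matrix.PosSemidef.one.quad_nonneg v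

/-- Moving a matrix to the other side of the standard inner product. -/
theorem dotProduct_mulVec_comm {m n : ℕ} (M : Matrix (Fin m) (Fin n) ℝ) (u : Fin m → ℝ)
    (v : Fin n → ℝ) : u ⬝ᵥ M *ᵥ v = (Mᵀ *ᵥ u) ⬝ᵥ v := by
  rw [dotProduct_mulVec, mulVec_transpose]

theorem quad_conj {n : ℕ} (U M : Matrix (Fin n) (Fin n) ℝ) (v : Fin n → ℝ) :
    v ⬝ᵥ (U * M * Uᵀ) *ᵥ v = (Uᵀ *ᵥ v) ⬝ᵥ M *ᵥ (Uᵀ *ᵥ v) := by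
  rw [← mulVec_mulVec, ← mulVec_mulVec, dotProduct_mulVec_comm]

theorem dotProduct_self_eq_norm_sq {n : ℕ} (v : Fin n → ℝ) :
    v ⬝ᵥ v = ‖WithLp.toLp 2 v‖ ^ 2 := by
  rw [EuclideanSpace.norm_sq_eq]
  simp [dotProduct, pow_two]

theorem norm_le_of_dotProduct_le {n : ℕ} (M : Matrix (Fin n) (Fin n) ℝ) {c : ℝ} (hc : 0 ≤ c)
    (h : ∀ v, (M *ᵥ v) ⬝ᵥ (M *ᵥ v) ≤ c ^ 2 * (v ⬝ᵥ v)) : ‖M‖ ≤ c := by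
  rw [← Matrix.l2_opNorm_toEuclideanCLM]
  refine ContinuousLinearMap.opNorm_le_bound _ hc fun x => ?_
  have h1 := h x.ofLp
  rw [dotProduct_self_eq_norm_sq, dotProduct_self_eq_norm_sq, ← mul_pow] at h1
  exact (sq_le_sq₀ (norm_nonneg _) (by positivity)).1 h1

theorem mulVec_dotProduct_le {n : ℕ} (M : Matrix (Fin n) (Fin n) ℝ) (v : Fin n → ℝ) :
    (M *ᵥ v) ⬝ᵥ (M *ᵥ v) ≤ ‖M‖ ^ 2 * (v ⬝ᵥ v) := by
  rw [dotProduct_self_eq_norm_sq, dotProduct_self_eq_norm_sq, ← mul_pow]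
  exact pow_le_pow_left₀ (norm_nonneg _) (Matrix.l2_opNorm_mulVec M (WithLp.toLp 2 v)) 2

/-- The Cauchy–Schwarz inequality for a positive semidefinite form. -/
theorem _root_.Matrix.PosSemidef.cauchySchwarz {n : ℕ} {M : Matrix (Fin n) (Fin n) ℝ}
    (h : M.PosSemidef) (u v : Fin n → ℝ) :
    (u ⬝ᵥ M *ᵥ v) ^ 2 ≤ (u ⬝ᵥ M *ᵥ u) * (v ⬝ᵥ M *ᵥ v) := by
  have hs : v ⬝ᵥ M *ᵥ u = u ⬝ᵥ M *ᵥ v := by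
    rw [dotProduct_mulVec_comm, h.transpose_eq, dotProduct_comm]
  have key : ∀ x : ℝ, 0 ≤ (v ⬝ᵥ M *ᵥ v) * (x * x) + 2 * (u ⬝ᵥ M *ᵥ v) * x + u ⬝ᵥ M *ᵥ u := by
    intro x
    have := h.quad_nonneg (u + x • v)
    simp only [mulVec_add, mulVec_smul, dotProduct_add, add_dotProduct, dotProduct_smul,
      smul_dotProduct, smul_eq_mul, hs] at this
    linarith
  have := discrim_le_zero key
  rw [discrim] at this
  nlinarith

theorem dotProduct_sq_le {n : ℕ} (u v : Fin n → ℝ) : (u ⬝ᵥ v) ^ 2 ≤ (u ⬝ᵥ u) * (v ⬝ᵥ v) := by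
  simpa using (Matrix.PosSemidef.one (n := Fin n) (R := ℝ)).cauchySchwarz u v

theorem dotProduct_mulVec_le_norm {n : ℕ} (M : Matrix (Fin n) (Fin n) ℝ) (v : Fin n → ℝ) :
    v ⬝ᵥ M *ᵥ v ≤ ‖M‖ * (v ⬝ᵥ v) := by
  refine abs_le_of_sq_le_sq' (b := ‖M‖ * (v ⬝ᵥ v)) ?_ ?_ |>.2
  · calc _ ≤ (v ⬝ᵥ v) * ((M *ᵥ v) ⬝ᵥ (M *ᵥ v)) := dotProduct_sq_le _ _
      _ ≤ (v ⬝ᵥ v) * (‖M‖ ^ 2 * (v ⬝ᵥ v)) :=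
        mul_le_mul_of_nonneg_left (mulVec_dotProduct_le M v) (dotProduct_self_nonneg v)
      _ = _ := by ring
  · exact mul_nonneg (norm_nonneg _) (dotProduct_self_nonneg v)

/-- The kernel of a positive semidefinite matrix is the null set of its quadratic form. -/
theorem _root_.Matrix.PosSemidef.mulVec_eq_zero {n : ℕ} {M : Matrix (Fin n) (Fin n) ℝ}
    (h : M.PosSemidef) {v : Fin n → ℝ} (hv : v ⬝ᵥ M *ᵥ v = 0) : M *ᵥ v = 0 := by
  have h1 := h.cauchySchwarz (M *ᵥ v) v
  rw [hv, mul_zero] at h1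
  exact dotProduct_self_eq_zero.1 (pow_eq_zero_iff two_ne_zero |>.1 (le_antisymm h1 (sq_nonneg _)))

theorem _root_.Matrix.PosSemidef.posDef_of_injective {n : ℕ} {M : Matrix (Fin n) (Fin n) ℝ}
    (h : M.PosSemidef) (hi : ∀ v, M *ᵥ v = 0 → v = 0) : M.PosDef := by
  refine posDef_iff_dotProduct.2 ⟨h.transpose_eq, fun v hv => ?_⟩
  exact (h.quad_nonneg v).lt_of_ne fun h0 => hv (hi v (h.mulVec_eq_zero h0.symm))

theorem _root_.Matrix.PosDef.inv_mul {n : ℕ} {M : Matrix (Fin n) (Fin n) ℝ} (h : M.PosDef) :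
    M⁻¹ * M = 1 := Matrix.nonsing_inv_mul _ ((Matrix.isUnit_iff_isUnit_det _).1 h.isUnit)

theorem _root_.Matrix.PosDef.mul_inv {n : ℕ} {M : Matrix (Fin n) (Fin n) ℝ} (h : M.PosDef) :
    M * M⁻¹ = 1 := Matrix.mul_nonsing_inv _ ((Matrix.isUnit_iff_isUnit_det _).1 h.isUnit)

/-- A positive definite matrix dominates a positive multiple of the identity. -/
theorem _root_.Matrix.PosDef.exists_lower_bound {n : ℕ} {M : Matrix (Fin n) (Fin n) ℝ}
    (h : M.PosDef) : ∃ c : ℝ, 0 < c ∧ ∀ v, c * (v ⬝ᵥ v) ≤ v ⬝ᵥ M *ᵥ v := by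
  refine ⟨(‖M⁻¹‖ + 1)⁻¹, by positivity, fun v => ?_⟩
  rw [inv_mul_le_iff₀ (by positivity)]
  have hM : M *ᵥ (M⁻¹ *ᵥ v) = v := by rw [mulVec_mulVec, h.mul_inv, one_mulVec]
  have h1 := h.posSemidef.cauchySchwarz v (M⁻¹ *ᵥ v)
  rw [hM, dotProduct_comm (M⁻¹ *ᵥ v)] at h1
  have h2 := dotProduct_mulVec_le_norm M⁻¹ v
  have h3 := h.posSemidef.quad_nonneg v
  have h4 := dotProduct_self_nonneg v
  rcases h4.eq_or_lt with h0 | h0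
  · rw [← h0]; positivity
  · refine le_of_mul_le_mul_right ?_ h0
    nlinarith

theorem _root_.Matrix.PosSemidef.norm_le {n : ℕ} {M : Matrix (Fin n) (Fin n) ℝ}
    (h : M.PosSemidef) {c : ℝ} (hc : 0 ≤ c) (hM : ∀ v, v ⬝ᵥ M *ᵥ v ≤ c * (v ⬝ᵥ v)) : ‖M‖ ≤ c := by
  refine norm_le_of_dotProduct_le M hc fun v => ?_
  have h1 := h.cauchySchwarz (M *ᵥ v) v
  have h2 : (M *ᵥ v ⬝ᵥ M *ᵥ v) ^ 2 ≤ (c * (M *ᵥ v ⬝ᵥ M *ᵥ v)) * (c * (v ⬝ᵥ v)) :=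
    h1.trans (mul_le_mul (hM _) (hM _) (h.quad_nonneg v)
      (mul_nonneg hc (dotProduct_self_nonneg _)))
  rcases (dotProduct_self_nonneg (M *ᵥ v)).eq_or_lt with h0 | h0
  · rw [← h0]; exact mul_nonneg (sq_nonneg _) (dotProduct_self_nonneg _)
  · refine le_of_mul_le_mul_right ?_ h0
    nlinarith

theorem l2_opNorm_transpose {n : ℕ} (M : Matrix (Fin n) (Fin n) ℝ) : ‖Mᵀ‖ = ‖M‖ := by
  rw [← Matrix.conjTranspose_eq_transpose_of_trivial, Matrix.l2_opNorm_conjTranspose]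

/-- A congruence transform preserves positive semidefiniteness. -/
theorem _root_.Matrix.PosSemidef.conj {n : ℕ} {M : Matrix (Fin n) (Fin n) ℝ}
    (h : M.PosSemidef) (U : Matrix (Fin n) (Fin n) ℝ) : (U * M * Uᵀ).PosSemidef := by
  simpa [Matrix.conjTranspose_eq_transpose_of_trivial] using h.mul_mul_conjTranspose_same U

theorem _root_.Matrix.PosSemidef.conj_symm {n : ℕ} {M X : Matrix (Fin n) (Fin n) ℝ}
    (h : M.PosSemidef) (hX : Xᵀ = X) : (X * M * X).PosSemidef := by
  simpa only [hX] using h.conj X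

theorem _root_.Matrix.PosDef.eq_zero_of_mulVec_eq_zero {n : ℕ} {M : Matrix (Fin n) (Fin n) ℝ}
    (h : M.PosDef) {v : Fin n → ℝ} (hv : M *ᵥ v = 0) : v = 0 := by
  by_contra h0
  have := h.quad_pos h0
  rw [hv, dotProduct_zero] at this
  exact this.false

theorem _root_.Matrix.PosDef.conj_posDef {n : ℕ} {M X : Matrix (Fin n) (Fin n) ℝ}
    (h : M.PosDef) (hX : X.PosDef) : (X * M * X).PosDef := by
  refine (h.posSemidef.conj_symm hX.posSemidef.transpose_eq).posDef_of_injective fun v hv => ?_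
  rw [← mulVec_mulVec, ← mulVec_mulVec] at hv
  exact hX.eq_zero_of_mulVec_eq_zero (h.eq_zero_of_mulVec_eq_zero (hX.eq_zero_of_mulVec_eq_zero hv))

/-! ### Stable matrices and the Lyapunov equation -/

theorem hasDerivWithinAt_transpose {n : ℕ} {f : ℝ → Matrix (Fin n) (Fin n) ℝ}
    {f' : Matrix (Fin n) (Fin n) ℝ} {s : Set ℝ} {t : ℝ} (h : HasDerivWithinAt f f' s t) :
    HasDerivWithinAt (fun t => (f t)ᵀ) f'ᵀ s t :=
  ((Matrix.transposeLinearEquiv (Fin n) (Fin n) ℝ ℝ).toLinearMap.toContinuousLinearMap.hasFDerivAt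
    (x := f t)).comp_hasDerivWithinAt t h

/-- The evaluation of a quadratic form, linear in the matrix. -/
def quadEval {n : ℕ} (v : Fin n → ℝ) : Matrix (Fin n) (Fin n) ℝ →ₗ[ℝ] ℝ where
  toFun M := v ⬝ᵥ M *ᵥ v
  map_add' := by intro M N; rw [add_mulVec, dotProduct_add]
  map_smul' := by intro c M; rw [smul_mulVec, dotProduct_smul]; rfl

theorem continuous_quad {n : ℕ} (v : Fin n → ℝ) :
    Continuous fun M : Matrix (Fin n) (Fin n) ℝ => v ⬝ᵥ M *ᵥ v :=
  (quadEval v).toContinuousLinearMap.continuous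

theorem hasDerivWithinAt_quad {n : ℕ} {f : ℝ → Matrix (Fin n) (Fin n) ℝ}
    {f' : Matrix (Fin n) (Fin n) ℝ} {s : Set ℝ} {t : ℝ} (h : HasDerivWithinAt f f' s t)
    (v : Fin n → ℝ) : HasDerivWithinAt (fun t => v ⬝ᵥ f t *ᵥ v) (v ⬝ᵥ f' *ᵥ v) s t :=
  ((quadEval v).toContinuousLinearMap.hasFDerivAt (x := f t)).comp_hasDerivWithinAt t h

theorem monotoneOn_Ici_of_hasDerivWithinAt {f f' : ℝ → ℝ}
    (h : ∀ t, 0 ≤ t → HasDerivWithinAt f (f' t) (Set.Ici 0) t) (h' : ∀ t, 0 ≤ t → 0 ≤ f' t) :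
    MonotoneOn f (Set.Ici 0) := by
  refine monotoneOn_of_hasDerivWithinAt_nonneg (f' := f') (convex_Ici 0)
    (fun t ht => (h t ht).continuousWithinAt) (fun t ht => ?_) fun t ht => ?_
  · exact (h t (interior_subset ht)).mono interior_subset
  · exact h' t (interior_subset ht)

/-- The exponential `exp (t B)`, the transition matrix of the autonomous equation `x' = B x`. -/
noncomputable def propagator {n : ℕ} (B : Matrix (Fin n) (Fin n) ℝ) (t : ℝ) :
    Matrix (Fin n) (Fin n) ℝ :=
  NormedSpace.exp (t • B)

theorem propagator_zero {n : ℕ} (B : Matrix (Fin n) (Fin n) ℝ) : propagator B 0 = 1 := by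
  simp [propagator]

theorem propagator_transpose {n : ℕ} (B : Matrix (Fin n) (Fin n) ℝ) (t : ℝ) :
    propagator Bᵀ t = (propagator B t)ᵀ := by
  rw [propagator, propagator, ← Matrix.exp_transpose, Matrix.transpose_smul]

theorem isUnit_propagator {n : ℕ} (B : Matrix (Fin n) (Fin n) ℝ) (t : ℝ) :
    IsUnit (propagator B t) := by
  let : NormedAlgebra ℚ (Matrix (Fin n) (Fin n) ℝ) := NormedAlgebra.restrictScalars ℚ ℝ _
  exact NormedSpace.isUnit_exp _

theorem hasDerivAt_propagator {n : ℕ} (B : Matrix (Fin n) (Fin n) ℝ) (t : ℝ) :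
    HasDerivAt (propagator B) (propagator B t * B) t := hasDerivAt_exp_smul_const B t

theorem hasDerivAt_propagator' {n : ℕ} (B : Matrix (Fin n) (Fin n) ℝ) (t : ℝ) :
    HasDerivAt (propagator B) (B * propagator B t) t := hasDerivAt_exp_smul_const' B t

/-- Along the congruence flow `Z ↦ exp (t B) Z exp (t B)'` the derivative is the congruence image of
the Lyapunov operator `B Z + Z B'`. -/
theorem hasDerivWithinAt_propagator_conj {n : ℕ} (B Z : Matrix (Fin n) (Fin n) ℝ) (s : Set ℝ)
    (t : ℝ) : HasDerivWithinAt (fun t => propagator B t * Z * (propagator B t)ᵀ)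
      (propagator B t * (B * Z + Z * Bᵀ) * (propagator B t)ᵀ) s t := by
  have h := (hasDerivAt_propagator B t).hasDerivWithinAt (s := s)
  refine ((h.mul_const Z).mul (hasDerivWithinAt_transpose h)).congr_deriv ?_
  rw [transpose_mul]
  noncomm_ring

/-- `B` is stable in the sense of Lyapunov: some positive definite `X` has
`B X + X B'` negative definite. -/
def LyapunovStable {n : ℕ} (B : Matrix (Fin n) (Fin n) ℝ) : Prop :=
  ∃ X : Matrix (Fin n) (Fin n) ℝ, X.PosDef ∧ (-(B * X + X * Bᵀ)).PosDef

/-- If `X` certifies the stability of `B`, then `X⁻¹` certifies that of `B'`. -/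
theorem LyapunovStable.transpose {n : ℕ} {B : Matrix (Fin n) (Fin n) ℝ} (h : LyapunovStable B) :
    LyapunovStable Bᵀ := by
  obtain ⟨X, hX, hB⟩ := h
  have e : -(Bᵀ * X⁻¹ + X⁻¹ * Bᵀᵀ) = X⁻¹ * (-(B * X + X * Bᵀ)) * X⁻¹ := by
    rw [transpose_transpose]
    have h1 : X⁻¹ * (-(B * X + X * Bᵀ)) * X⁻¹
      = -(X⁻¹ * B * (X * X⁻¹) + (X⁻¹ * X) * Bᵀ * X⁻¹) := by noncomm_ring
    rw [h1, hX.mul_inv, hX.inv_mul, mul_one, one_mul, add_comm]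
  refine ⟨X⁻¹, hX.inv, ?_⟩
  rw [e]
  exact hB.conj_posDef hX.inv

/-- A Lyapunov certificate gives exponential decay of the propagator. -/
theorem LyapunovStable.exists_norm_propagator_le {n : ℕ} {B : Matrix (Fin n) (Fin n) ℝ}
    (h : LyapunovStable B) : ∃ K ν : ℝ, 0 < K ∧ 0 < ν ∧
      ∀ t, 0 ≤ t → ‖propagator B t‖ ≤ K * Real.exp (-(2 * ν * t)) := by
  obtain ⟨X, hX, hB⟩ := h
  obtain ⟨c, hc, hcX⟩ := hX.exists_lower_bound
  obtain ⟨b, hb, hbB⟩ := hB.exists_lower_bound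
  -- the rate is chosen so that `4 ν X ≤ -(B X + X B')`
  set ν := b / (4 * (‖X‖ + 1)) with hν
  have hν0 : 0 < ν := by positivity
  have hνX : ∀ v, 4 * ν * (v ⬝ᵥ X *ᵥ v) ≤ v ⬝ᵥ (-(B * X + X * Bᵀ)) *ᵥ v := fun v => by
    have h1 : v ⬝ᵥ X *ᵥ v ≤ (‖X‖ + 1) * (v ⬝ᵥ v) :=
      (dotProduct_mulVec_le_norm X v).trans (mul_le_mul_of_nonneg_right (by linarith)
        (dotProduct_self_nonneg v))
    refine le_trans ?_ (hbB v)
    calc 4 * ν * (v ⬝ᵥ X *ᵥ v) ≤ 4 * ν * ((‖X‖ + 1) * (v ⬝ᵥ v)) := by gcongr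
      _ = b * (v ⬝ᵥ v) := by rw [hν]; field_simp
  refine ⟨Real.sqrt ((‖X‖ + 1) / c), ν, by positivity, hν0, fun t ht => ?_⟩
  rw [← l2_opNorm_transpose]
  refine norm_le_of_dotProduct_le _ (by positivity) fun v => ?_
  -- `exp (4 ν t) v' E X E' v` is antitone
  have hd : ∀ t : ℝ, 0 ≤ t → HasDerivWithinAt
      (fun t => -(Real.exp (4 * ν * t) * (v ⬝ᵥ (propagator B t * X * (propagator B t)ᵀ) *ᵥ v)))
      (Real.exp (4 * ν * t) * (v ⬝ᵥ (propagator B t * (-(B * X + X * Bᵀ)) * (propagator B t)ᵀ) *ᵥ v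
        - 4 * ν * (v ⬝ᵥ (propagator B t * X * (propagator B t)ᵀ) *ᵥ v))) (Set.Ici 0) t := by
    intro t _
    have h1 := hasDerivWithinAt_quad (hasDerivWithinAt_propagator_conj B X (Set.Ici 0) t) v
    have h2 : HasDerivWithinAt (fun t => Real.exp (4 * ν * t)) (Real.exp (4 * ν * t) * (4 * ν))
        (Set.Ici 0) t := by
      simpa using ((hasDerivAt_id t).const_mul (4 * ν)).exp.hasDerivWithinAt
    refine (h2.mul h1).neg.congr_deriv ?_
    rw [mul_neg, neg_mul, neg_mulVec, dotProduct_neg]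
    ring
  have hm := monotoneOn_Ici_of_hasDerivWithinAt hd (fun t _ => mul_nonneg (Real.exp_pos _).le (by
    rw [quad_conj, quad_conj]
    linarith [hνX ((propagator B t)ᵀ *ᵥ v)])) (Set.mem_Ici.2 le_rfl) (Set.mem_Ici.2 ht) ht
  simp only [propagator_zero, mul_zero, Real.exp_zero, one_mul, transpose_one, mul_one] at hm
  rw [neg_le_neg_iff, quad_conj] at hm
  set w := (propagator B t)ᵀ *ᵥ v
  have h1 := hcX w
  have h2 := dotProduct_mulVec_le_norm X v
  have h3 := dotProduct_self_nonneg v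
  have he : (Real.sqrt ((‖X‖ + 1) / c) * Real.exp (-(2 * ν * t))) ^ 2
      = (‖X‖ + 1) / c * (Real.exp (4 * ν * t))⁻¹ := by
    rw [mul_pow, Real.sq_sqrt (by positivity), ← Real.exp_neg, ← Real.exp_nat_mul]
    congr 2
    push_cast
    ring
  rw [he]
  have hE := Real.exp_pos (4 * ν * t)
  have h4 : Real.exp (4 * ν * t) * (c * (w ⬝ᵥ w)) ≤ (‖X‖ + 1) * (v ⬝ᵥ v) := by
    have := mul_le_mul_of_nonneg_left h1 hE.le
    linarith
  calc w ⬝ᵥ w = Real.exp (4 * ν * t) * (c * (w ⬝ᵥ w)) * (c⁻¹ * (Real.exp (4 * ν * t))⁻¹) := by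
        field_simp
    _ ≤ (‖X‖ + 1) * (v ⬝ᵥ v) * (c⁻¹ * (Real.exp (4 * ν * t))⁻¹) := by gcongr
    _ = _ := by ring

theorem LyapunovStable.tendsto_propagator {n : ℕ} {B : Matrix (Fin n) (Fin n) ℝ}
    (h : LyapunovStable B) : Filter.Tendsto (propagator B) Filter.atTop (nhds 0) := by
  obtain ⟨K, ν, hK, hν, hE⟩ := h.exists_norm_propagator_le
  have h1 : Filter.Tendsto (fun t : ℝ => K * Real.exp (-(2 * ν * t))) Filter.atTop (nhds 0) := by
    rw [← mul_zero K]
    refine (Real.tendsto_exp_neg_atTop_nhds_zero.comp ?_).const_mul K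
    exact Filter.tendsto_id.const_mul_atTop (by positivity)
  exact squeeze_zero_norm' (Filter.eventually_atTop.2 ⟨0, fun t ht => hE t ht⟩) h1

theorem LyapunovStable.tendsto_conj {n : ℕ} {B : Matrix (Fin n) (Fin n) ℝ}
    (h : LyapunovStable B) (Z : Matrix (Fin n) (Fin n) ℝ) :
    Filter.Tendsto (fun t => propagator B t * Z * (propagator B t)ᵀ) Filter.atTop (nhds 0) := by
  have h1 := h.tendsto_propagator
  have h2 := h.transpose.tendsto_propagator
  simp only [funext (propagator_transpose B)] at h2
  simpa using (h1.mul_const Z).mul h2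

/-- For stable `B` the Lyapunov operator reverses the sign: `Z` is positive semidefinite as soon as
`-(B Z + Z B')` is. -/
theorem LyapunovStable.posSemidef {n : ℕ} {B : Matrix (Fin n) (Fin n) ℝ}
    (h : LyapunovStable B) {Z : Matrix (Fin n) (Fin n) ℝ} (hZ : Zᵀ = Z)
    (hB : (-(B * Z + Z * Bᵀ)).PosSemidef) : Z.PosSemidef := by
  refine posSemidef_iff_dotProduct.2 ⟨hZ, fun v => ?_⟩
  have hm := monotoneOn_Ici_of_hasDerivWithinAt
    (f := fun t => -(v ⬝ᵥ (propagator B t * Z * (propagator B t)ᵀ) *ᵥ v))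
    (fun t _ => (hasDerivWithinAt_quad (hasDerivWithinAt_propagator_conj B Z (Set.Ici 0) t) v).neg)
    (fun t _ => by
      rw [quad_conj, ← dotProduct_neg, ← neg_mulVec]
      exact hB.quad_nonneg _)
  have hl : Filter.Tendsto (fun t => v ⬝ᵥ (propagator B t * Z * (propagator B t)ᵀ) *ᵥ v)
      Filter.atTop (nhds 0) := by
    have := ((continuous_quad v).tendsto 0).comp (h.tendsto_conj Z)
    rw [zero_mulVec, dotProduct_zero] at this
    exact this
  refine le_of_tendsto hl (Filter.eventually_atTop.2 ⟨0, fun t ht => ?_⟩)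
  have := hm (Set.mem_Ici.2 le_rfl) (Set.mem_Ici.2 ht) ht
  simp only [propagator_zero, one_mul, transpose_one, mul_one, neg_le_neg_iff] at this
  exact this

/-- The symmetric matrices. -/
def symmetricMatrices (n : ℕ) : Submodule ℝ (Matrix (Fin n) (Fin n) ℝ) where
  carrier := {Z | Zᵀ = Z}
  add_mem' := by
    intro a b (ha : aᵀ = a) (hb : bᵀ = b)
    change (a + b)ᵀ = a + b
    rw [transpose_add, ha, hb]
  zero_mem' := transpose_zero
  smul_mem' := by
    intro c a (ha : aᵀ = a)
    change (c • a)ᵀ = c • a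
    rw [transpose_smul, ha]

/-- The Lyapunov operator `Z ↦ B Z + Z B'` on symmetric matrices. -/
def lyapunovOperator {n : ℕ} (B : Matrix (Fin n) (Fin n) ℝ) :
    symmetricMatrices n →ₗ[ℝ] symmetricMatrices n where
  toFun Z := ⟨B * (Z : Matrix (Fin n) (Fin n) ℝ) + (Z : Matrix (Fin n) (Fin n) ℝ) * Bᵀ, by
    have hZ : (Z : Matrix (Fin n) (Fin n) ℝ)ᵀ = Z := Z.2
    change (B * (Z : Matrix (Fin n) (Fin n) ℝ) + (Z : Matrix (Fin n) (Fin n) ℝ) * Bᵀ)ᵀ = _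
    rw [transpose_add, transpose_mul, transpose_mul, hZ, transpose_transpose, add_comm]⟩
  map_add' := by
    intro Y Z
    ext1
    simp only [Submodule.coe_add, mul_add, add_mul]
    abel
  map_smul' := by
    intro c Z
    ext1
    simp [smul_add]

/-- The Lyapunov equation is solvable for stable `B`: its operator is injective by the sign rule
`LyapunovStable.posSemidef`, hence surjective by finite dimension. -/
theorem LyapunovStable.exists_solution {n : ℕ} {B : Matrix (Fin n) (Fin n) ℝ}
    (h : LyapunovStable B) {M : Matrix (Fin n) (Fin n) ℝ} (hM : Mᵀ = M) :
    ∃ Z : Matrix (Fin n) (Fin n) ℝ, Zᵀ = Z ∧ B * Z + Z * Bᵀ = M := by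
  have hinj : Function.Injective (lyapunovOperator B) := by
    rw [injective_iff_map_eq_zero]
    rintro ⟨Z, hZ : Zᵀ = Z⟩ h0
    have h1 : B * Z + Z * Bᵀ = 0 := congrArg Subtype.val h0
    have hp : Z.PosSemidef := h.posSemidef hZ (by rw [h1, neg_zero]; exact Matrix.PosSemidef.zero)
    have hn : (-Z).PosSemidef := h.posSemidef (by rw [transpose_neg, hZ]) (by
      rw [mul_neg, neg_mul, ← neg_add, h1, neg_zero, neg_zero]; exact Matrix.PosSemidef.zero)
    ext1
    change Z = 0
    refine Matrix.ext_of_mulVec_single fun i => ?_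
    rw [zero_mulVec]
    refine hp.mulVec_eq_zero (le_antisymm ?_ (hp.quad_nonneg _))
    have := hn.quad_nonneg (Pi.single i 1)
    rw [neg_mulVec, dotProduct_neg] at this
    linarith
  obtain ⟨⟨Z, hZ⟩, hZM⟩ := LinearMap.injective_iff_surjective.1 hinj ⟨M, hM⟩
  exact ⟨Z, hZ, congrArg Subtype.val hZM⟩

/-! ### The algebraic Riccati equation -/

/-- The hypotheses on the coefficients of the Riccati equation: `R` is positive definite, `S` is
positive semidefinite, and `(A, S)` is observable (no nonzero vector has all `S Aᵏ v = 0`). -/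
structure RiccatiData {r : ℕ} (A R S : Matrix (Fin r) (Fin r) ℝ) : Prop where
  posDef : R.PosDef
  posSemidef : S.PosSemidef
  observable : ∀ v, (∀ k : ℕ, S *ᵥ (A ^ k *ᵥ v) = 0) → v = 0

/-- An `A`-invariant set of vectors inside the kernel of `S` is trivial. -/
theorem RiccatiData.eq_zero_of_invariant {r : ℕ} {A R S : Matrix (Fin r) (Fin r) ℝ}
    (h : RiccatiData A R S) {p : (Fin r → ℝ) → Prop} (hS : ∀ v, p v → S *ᵥ v = 0)
    (hA : ∀ v, p v → p (A *ᵥ v)) {v : Fin r → ℝ} (hv : p v) : v = 0 := by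
  have hk : ∀ k : ℕ, p (A ^ k *ᵥ v) := by
    intro k
    induction k with
    | zero => simpa using hv
    | succ k ih => rw [pow_succ', ← mulVec_mulVec]; exact hA _ ih
  exact h.observable v fun k => hS _ (hk k)

theorem RiccatiData.smul {r : ℕ} {A R S : Matrix (Fin r) (Fin r) ℝ}
    (h : RiccatiData A R S) {c : ℝ} (hc : 0 < c) : RiccatiData A R (c • S) where
  posDef := h.posDef
  posSemidef := h.posSemidef.smul hc.le
  observable := by
    intro v hv
    refine h.observable v fun k => ?_
    have := hv k
    rw [smul_mulVec] at this
    exact (smul_eq_zero.1 this).resolve_left hc.ne'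

/-- The rank condition makes the stacked matrix injective, and
`S = C' Σ⁻¹ C` has the kernel of `C`. -/
theorem riccatiData_of_isObservable {r r' : ℕ} {A : Matrix (Fin r) (Fin r) ℝ}
    {C : Matrix (Fin r') (Fin r) ℝ} {R : Matrix (Fin r) (Fin r) ℝ}
    {Sig : Matrix (Fin r') (Fin r') ℝ} (hR : R.PosDef) (hSig : Sig.PosDef)
    (hobs : IsObservable A C) : RiccatiData A R (Cᵀ * Sig⁻¹ * C) := by
  have hps : (Cᵀ * Sig⁻¹ * C).PosSemidef := by
    simpa [Matrix.conjTranspose_eq_transpose_of_trivial] using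
      hSig.inv.posSemidef.conjTranspose_mul_mul_same C
  refine ⟨hR, hps, fun v hv => ?_⟩
  have hC : ∀ w, (Cᵀ * Sig⁻¹ * C) *ᵥ w = 0 → C *ᵥ w = 0 := by
    intro w hw
    by_contra h0
    have h1 := hSig.inv.quad_pos h0
    have h2 : w ⬝ᵥ (Cᵀ * Sig⁻¹ * C) *ᵥ w = (C *ᵥ w) ⬝ᵥ Sig⁻¹ *ᵥ (C *ᵥ w) := by
      rw [← mulVec_mulVec, ← mulVec_mulVec, dotProduct_mulVec_comm, transpose_transpose]
    rw [← h2, hw, dotProduct_zero] at h1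
    exact h1.false
  have hO : (observabilityMatrix A C).mulVecLin v = 0 := by
    ext p
    have h1 := congrFun (hC _ (hv p.1)) p.2
    rw [mulVec_mulVec] at h1
    exact h1
  have hker : LinearMap.ker (observabilityMatrix A C).mulVecLin = ⊥ := by
    have h1 := LinearMap.finrank_range_add_finrank_ker (observabilityMatrix A C).mulVecLin
    have h2 : Module.finrank ℝ (LinearMap.range (observabilityMatrix A C).mulVecLin) = r := hobs
    rw [h2, Module.finrank_fin_fun] at h1
    exact Submodule.finrank_eq_zero.1 (by omega)
  exact LinearMap.ker_eq_bot'.1 hker v hO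

theorem isClosed_posSemidef (n : ℕ) : IsClosed {M : Matrix (Fin n) (Fin n) ℝ | M.PosSemidef} := by
  simp only [posSemidef_iff_dotProduct, Set.ofPred_and, Set.ofPred_forall]
  refine (isClosed_eq (Continuous.matrix_transpose continuous_id) continuous_id).inter
    (isClosed_iInter fun v => isClosed_le continuous_const (continuous_quad v))

theorem continuous_riccatiDrift {r : ℕ} (A R S : Matrix (Fin r) (Fin r) ℝ) :
    Continuous (riccatiDrift A R S) := by
  unfold riccatiDrift
  fun_prop

theorem riccatiDrift_transpose {r : ℕ} {A R S Q : Matrix (Fin r) (Fin r) ℝ} (hR : Rᵀ = R)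
    (hS : Sᵀ = S) (hQ : Qᵀ = Q) : (riccatiDrift A R S Q)ᵀ = riccatiDrift A R S Q := by
  simp only [riccatiDrift, transpose_add, transpose_sub, transpose_mul, transpose_transpose, hR, hS,
    hQ]
  rw [add_comm (Q * Aᵀ), Matrix.mul_assoc Q S Q]

/-- The closed-loop form of the Riccati drift. -/
theorem lyapunov_closedLoop {r : ℕ} {A R S Q : Matrix (Fin r) (Fin r) ℝ}
    (hS : Sᵀ = S) (hQ : Qᵀ = Q) :
    -((A - Q * S) * Q + Q * (A - Q * S)ᵀ) = (R + Q * S * Q) + -riccatiDrift A R S Q := by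
  simp only [riccatiDrift, transpose_sub, transpose_mul, hS, hQ]
  noncomm_ring

/-- A positive semidefinite supersolution of the algebraic Riccati equation is positive definite,
and its closed-loop matrix is stable. -/
theorem RiccatiData.stable_of_supersolution {r : ℕ} {A R S X : Matrix (Fin r) (Fin r) ℝ}
    (h : RiccatiData A R S) (hX : X.PosSemidef) (hF : (-riccatiDrift A R S X).PosSemidef) :
    X.PosDef ∧ LyapunovStable (A - X * S) := by
  have hX' := hX.transpose_eq
  have hpos : X.PosDef := by
    refine hX.posDef_of_injective fun v hv => ?_
    by_contra h0
    have h1 := hF.quad_nonneg v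
    have h2 := h.posDef.quad_pos h0
    have h3 : v ⬝ᵥ (-riccatiDrift A R S X) *ᵥ v = -(v ⬝ᵥ R *ᵥ v) := by
      simp only [riccatiDrift, neg_mulVec, add_mulVec, sub_mulVec, ← mulVec_mulVec, hv,
        mulVec_zero, dotProduct_neg, dotProduct_add, dotProduct_sub, dotProduct_zero]
      rw [dotProduct_mulVec_comm X v, hX', hv, zero_dotProduct]
      ring
    linarith
  refine ⟨hpos, X, hpos, ?_⟩
  rw [lyapunov_closedLoop h.posSemidef.transpose_eq hX']
  exact (h.posDef.add_posSemidef (h.posSemidef.conj_symm hX')).add_posSemidef hF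

/-- The algebraic Riccati equation has a positive semidefinite supersolution. It is a multiple of
the inverse of the observability Gramian of a shift of `A`. -/
theorem RiccatiData.exists_supersolution {r : ℕ} {A R S : Matrix (Fin r) (Fin r) ℝ}
    (h : RiccatiData A R S) :
    ∃ U : Matrix (Fin r) (Fin r) ℝ, U.PosSemidef ∧ (-riccatiDrift A R S U).PosSemidef := by
  have hS := h.posSemidef.transpose_eq
  set β := ‖A‖ + 1 with hβ
  have hβ0 : 0 < β := by positivity
  set A' := A + β • (1 : Matrix (Fin r) (Fin r) ℝ) with hA'
  have hst : LyapunovStable (-A'ᵀ) := by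
    refine ⟨1, Matrix.PosDef.one, posDef_iff_dotProduct.2 ⟨?_, fun v hv => ?_⟩⟩
    · simp only [mul_one, one_mul, transpose_neg, transpose_add, transpose_transpose]
      rw [add_comm]
    · have h1 := dotProduct_mulVec_le_norm (-A) v
      rw [norm_neg] at h1
      have h2 : 0 < v ⬝ᵥ v := by simpa using Matrix.PosDef.one.quad_pos hv
      have h3 : v ⬝ᵥ Aᵀ *ᵥ v = v ⬝ᵥ A *ᵥ v := by
        rw [dotProduct_mulVec_comm, transpose_transpose, dotProduct_comm]
      simp only [hA', mul_one, one_mul, transpose_neg, transpose_add, transpose_transpose,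
        transpose_smul, transpose_one, neg_mulVec, add_mulVec, smul_mulVec, one_mulVec,
        dotProduct_neg, dotProduct_add, dotProduct_smul, smul_eq_mul, h3] at h1 ⊢
      nlinarith
  obtain ⟨Y, hYt, hY⟩ := hst.exists_solution (M := -S) (by rw [transpose_neg, hS])
  have hYS : A'ᵀ * Y + Y * A' = S := by
    have h1 : A'ᵀ * Y + Y * A' = -(-A'ᵀ * Y + Y * (-A'ᵀ)ᵀ) := by
      rw [transpose_neg, transpose_transpose]; noncomm_ring
    rw [h1, hY, neg_neg]
  have hYp : Y.PosSemidef := hst.posSemidef hYt (by rw [hY, neg_neg]; exact h.posSemidef)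
  have hker : ∀ v, Y *ᵥ v = 0 → S *ᵥ v = 0 := by
    intro v hv
    refine h.posSemidef.mulVec_eq_zero ?_
    rw [← hYS, add_mulVec, dotProduct_add, ← mulVec_mulVec, hv, ← mulVec_mulVec,
      dotProduct_mulVec_comm Y, hYt, hv]
    simp
  have hYd : Y.PosDef := by
    refine hYp.posDef_of_injective fun v hv => ?_
    refine h.eq_zero_of_invariant (p := fun v => Y *ᵥ v = 0) hker (fun v hv => ?_) hv
    have h1 := hker v hv
    rw [← hYS, add_mulVec, ← mulVec_mulVec, hv, mulVec_zero, zero_add, ← mulVec_mulVec, hA',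
      add_mulVec, smul_mulVec, one_mulVec, mulVec_add, mulVec_smul, hv, smul_zero, add_zero] at h1
    exact h1
  set G := Y⁻¹ with hG
  have hGd : G.PosDef := hYd.inv
  have hGt : Gᵀ = G := hGd.posSemidef.transpose_eq
  have hGS : A * G + G * Aᵀ = G * S * G - (2 * β) • G := by
    have h1 : G * S * G = G * A'ᵀ * (Y * G) + (G * Y) * A' * G := by
      rw [← hYS]; noncomm_ring
    rw [h1, hG, hYd.mul_inv, hYd.inv_mul, hA', transpose_add, transpose_smul, transpose_one]
    simp only [mul_add, add_mul, mul_one, one_mul, Matrix.mul_smul, Matrix.smul_mul]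
    module
  obtain ⟨p, hp, hpG⟩ := hGd.exists_lower_bound
  -- the multiple is large enough for `2 β c G ≥ R`
  set c := 1 + ‖R‖ / (2 * β * p) with hc
  have hc1 : 1 ≤ c := by rw [hc]; linarith [show 0 ≤ ‖R‖ / (2 * β * p) by positivity]
  have hcR : ‖R‖ ≤ 2 * β * c * p := by
    have : 2 * β * c * p = 2 * β * p + ‖R‖ := by rw [hc]; field_simp
    rw [this]; linarith [show 0 < 2 * β * p by positivity]
  have hUp : (c • G).PosSemidef := hGd.posSemidef.smul (by linarith)
  refine ⟨c • G, hUp, posSemidef_iff_dotProduct.2 ⟨?_, fun v => ?_⟩⟩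
  · rw [transpose_neg, riccatiDrift_transpose h.posDef.posSemidef.transpose_eq hS hUp.transpose_eq]
  · have e : -riccatiDrift A R S (c • G) = (c ^ 2 - c) • (G * S * G) + ((2 * β * c) • G - R) := by
      have : riccatiDrift A R S (c • G) = c • (A * G + G * Aᵀ) - c ^ 2 • (G * S * G) + R := by
        simp only [riccatiDrift, Matrix.mul_smul, Matrix.smul_mul]
        module
      rw [this, hGS]
      module
    rw [e, add_mulVec, dotProduct_add, sub_mulVec, dotProduct_sub, smul_mulVec, smul_mulVec,
      dotProduct_smul, dotProduct_smul, smul_eq_mul, smul_eq_mul]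
    have h1 := (h.posSemidef.conj_symm hGt).quad_nonneg v
    have h2 := dotProduct_mulVec_le_norm R v
    have h3 := hpG v
    have h4 := dotProduct_self_nonneg v
    have h5 : 0 ≤ (c ^ 2 - c) * (v ⬝ᵥ (G * S * G) *ᵥ v) := mul_nonneg (by nlinarith) h1
    have h6 : 2 * β * c * (p * (v ⬝ᵥ v)) ≤ 2 * β * c * (v ⬝ᵥ G *ᵥ v) := by gcongr
    nlinarith

theorem _root_.Matrix.PosSemidef.eq_zero_of_trace_nonpos {n : ℕ} {M : Matrix (Fin n) (Fin n) ℝ}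
    (h : M.PosSemidef) (ht : M.trace ≤ 0) : M = 0 :=
  h.trace_eq_zero_iff.1 (le_antisymm ht h.trace_nonneg)

/-- Existence of the positive definite, stabilizing solution of the algebraic Riccati equation.
It is found as a supersolution of minimal trace below a given one: a Newton step
from a supersolution `X` is again a supersolution, lies below `X`, and fixes `X` only
if `X` is a solution. -/
theorem RiccatiData.exists_steadyState {r : ℕ} {A R S : Matrix (Fin r) (Fin r) ℝ}
    (h : RiccatiData A R S) : ∃ P : Matrix (Fin r) (Fin r) ℝ, P.PosDef ∧ riccatiDrift A R S P = 0 ∧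
      LyapunovStable (A - P * S) := by
  have hS := h.posSemidef.transpose_eq
  obtain ⟨U, hU, hUF⟩ := h.exists_supersolution
  set T : Set (Matrix (Fin r) (Fin r) ℝ) :=
    {X | X.PosSemidef ∧ (-riccatiDrift A R S X).PosSemidef ∧ (U - X).PosSemidef} with hT
  have hcl : IsClosed T := by
    have hc := continuous_riccatiDrift A R S
    exact (isClosed_posSemidef r).inter (((isClosed_posSemidef r).preimage hc.neg).inter
      ((isClosed_posSemidef r).preimage (continuous_const.sub continuous_id)))
  have hbd : T ⊆ Metric.closedBall 0 ‖U‖ := by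
    rintro X ⟨hX, -, hXU⟩
    rw [mem_closedBall_zero_iff]
    refine hX.norm_le (norm_nonneg _) fun v => ?_
    have h1 := hXU.quad_nonneg v
    rw [sub_mulVec, dotProduct_sub] at h1
    linarith [dotProduct_mulVec_le_norm U v]
  have hcomp : IsCompact T := (isCompact_closedBall 0 ‖U‖).of_isClosed_subset hcl hbd
  obtain ⟨X, ⟨hX, hXF, hXU⟩, hmin⟩ := hcomp.exists_isMinOn (f := fun X => X.trace)
    ⟨U, hU, hUF, by rw [sub_self]; exact Matrix.PosSemidef.zero⟩
    (Continuous.matrix_trace continuous_id).continuousOn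
  obtain ⟨hXd, hst⟩ := h.stable_of_supersolution hX hXF
  have hXt := hX.transpose_eq
  obtain ⟨Z, hZt, hZ⟩ := hst.exists_solution (M := -riccatiDrift A R S X) hXF.transpose_eq
  have hnZ : (-Z).PosSemidef := hst.posSemidef (by rw [transpose_neg, hZt]) (by
    have : -((A - X * S) * -Z + -Z * (A - X * S)ᵀ) = -riccatiDrift A R S X := by
      rw [← hZ]; noncomm_ring
    rw [this]; exact hXF)
  have hXZ : (X + Z).PosSemidef := hst.posSemidef (by rw [transpose_add, hXt, hZt]) (by
    have : -((A - X * S) * (X + Z) + (X + Z) * (A - X * S)ᵀ) = R + X * S * X := by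
      have e1 : -((A - X * S) * (X + Z) + (X + Z) * (A - X * S)ᵀ)
        = -((A - X * S) * X + X * (A - X * S)ᵀ) - ((A - X * S) * Z + Z * (A - X * S)ᵀ) := by
        noncomm_ring
      rw [e1, hZ, lyapunov_closedLoop (R := R) hS hXt]
      abel
    rw [this]
    exact h.posDef.posSemidef.add (h.posSemidef.conj_symm hXt))
  have hFXZ : -riccatiDrift A R S (X + Z) = Z * S * Z := by
    have : -riccatiDrift A R S (X + Z)
        = -riccatiDrift A R S X - ((A - X * S) * Z + Z * (A - X * S)ᵀ) + Z * S * Z := by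
      simp only [riccatiDrift, transpose_sub, transpose_mul, hS, hXt]
      noncomm_ring
    rw [this, hZ, sub_self, zero_add]
  have hmem : X + Z ∈ T := by
    refine ⟨hXZ, ?_, ?_⟩
    · rw [hFXZ]; exact h.posSemidef.conj_symm hZt
    · rw [← sub_sub, sub_eq_add_neg (U - X)]; exact hXU.add hnZ
  have htr : X.trace ≤ (X + Z).trace := hmin hmem
  rw [trace_add] at htr
  have hZ0 : Z = 0 := neg_eq_zero.1 (hnZ.eq_zero_of_trace_nonpos (by rw [trace_neg]; linarith))
  refine ⟨X, hXd, ?_, hst⟩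
  rw [hZ0, mul_zero, zero_mul, add_zero] at hZ
  exact neg_eq_zero.1 hZ.symm

/-! ### The Riccati flow in closed form -/

theorem norm_one_le (n : ℕ) : ‖(1 : Matrix (Fin n) (Fin n) ℝ)‖ ≤ 1 :=
  norm_le_of_dotProduct_le _ zero_le_one fun v => by simp

theorem isUnit_of_mulVec_injective {n : ℕ} {M : Matrix (Fin n) (Fin n) ℝ}
    (h : ∀ v, M *ᵥ v = 0 → v = 0) : IsUnit M := by
  rw [← Matrix.mulVec_injective_iff_isUnit]
  intro u v huv
  exact sub_eq_zero.1 (h _ (by rw [mulVec_sub]; exact sub_eq_zero.2 huv))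

theorem _root_.IsUnit.matrix_inv_mul {n : ℕ} {M : Matrix (Fin n) (Fin n) ℝ} (h : IsUnit M) :
    M⁻¹ * M = 1 := Matrix.nonsing_inv_mul _ ((Matrix.isUnit_iff_isUnit_det _).1 h)

theorem _root_.IsUnit.matrix_mul_inv {n : ℕ} {M : Matrix (Fin n) (Fin n) ℝ} (h : IsUnit M) :
    M * M⁻¹ = 1 := Matrix.mul_nonsing_inv _ ((Matrix.isUnit_iff_isUnit_det _).1 h)

theorem hasDerivWithinAt_matrix_inv {n : ℕ} {f : ℝ → Matrix (Fin n) (Fin n) ℝ}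
    {f' : Matrix (Fin n) (Fin n) ℝ} {s : Set ℝ} {t : ℝ} (h : HasDerivWithinAt f f' s t)
    (hu : IsUnit (f t)) :
    HasDerivWithinAt (fun t => (f t)⁻¹) (-((f t)⁻¹ * f' * (f t)⁻¹)) s t := by
  obtain ⟨u, hu'⟩ := hu
  have h1 := hasFDerivAt_ringInverse (𝕜 := ℝ) u
  rw [hu'] at h1
  have h2 := h1.comp_hasDerivWithinAt t h
  have h3 : ((u⁻¹ : (Matrix (Fin n) (Fin n) ℝ)ˣ) : Matrix (Fin n) (Fin n) ℝ) = (f t)⁻¹ := by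
    rw [← hu', Matrix.coe_units_inv]
  simp only [h3] at h2
  refine (h2.congr (fun x _ => Matrix.nonsing_inv_eq_ringInverse _)
    (Matrix.nonsing_inv_eq_ringInverse _)).congr_deriv ?_
  simp

/-- A stationary point of the Riccati equation with the data of its linearization: `P` is the
stabilizing solution of the algebraic Riccati equation, `Γ` is the observability Gramian of
the closed-loop matrix `A - P S` on `[0, ∞)`, and `c` quantifies the strict inequality
`Γ < P⁻¹`. -/
structure SteadyState {r : ℕ} (A R S : Matrix (Fin r) (Fin r) ℝ) where
  /-- the stationary covariance -/
  P : Matrix (Fin r) (Fin r) ℝ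
  /-- the infinite-horizon observability Gramian of the closed-loop matrix -/
  Γ : Matrix (Fin r) (Fin r) ℝ
  /-- the size of the gap between `P Γ P` and `P` -/
  c : ℝ
  data : RiccatiData A R S
  posDef : P.PosDef
  drift_eq : riccatiDrift A R S P = 0
  stable : LyapunovStable (A - P * S)
  gramian_posDef : Γ.PosDef
  gramian_eq : (A - P * S)ᵀ * Γ + Γ * (A - P * S) = -S
  c_pos : 0 < c
  gap : ∀ u, c * (u ⬝ᵥ u) ≤ u ⬝ᵥ (P - P * Γ * P) *ᵥ u

theorem RiccatiData.nonempty_steadyState {r : ℕ} {A R S : Matrix (Fin r) (Fin r) ℝ}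
    (h : RiccatiData A R S) : Nonempty (SteadyState A R S) := by
  obtain ⟨P, hP, hF, hst⟩ := h.exists_steadyState
  have hS := h.posSemidef.transpose_eq
  have hPt := hP.posSemidef.transpose_eq
  set B := A - P * S with hB
  obtain ⟨Γ, hΓt, hΓ⟩ := hst.transpose.exists_solution (M := -S) (by rw [transpose_neg, hS])
  have hΓp : Γ.PosSemidef := hst.transpose.posSemidef hΓt (by rw [hΓ, neg_neg]; exact h.posSemidef)
  rw [transpose_transpose] at hΓ
  have hker : ∀ v, Γ *ᵥ v = 0 → S *ᵥ v = 0 := by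
    intro v hv
    refine h.posSemidef.mulVec_eq_zero ?_
    have h1 : S = -(Bᵀ * Γ + Γ * B) := by rw [hΓ, neg_neg]
    rw [h1, neg_mulVec, dotProduct_neg, add_mulVec, dotProduct_add, ← mulVec_mulVec, hv,
      ← mulVec_mulVec, dotProduct_mulVec_comm Γ, hΓt, hv]
    simp
  have hΓd : Γ.PosDef := by
    refine hΓp.posDef_of_injective fun v hv => ?_
    refine h.eq_zero_of_invariant (p := fun v => Γ *ᵥ v = 0) hker (fun v hv => ?_) hv
    have h1 : (Bᵀ * Γ + Γ * B) *ᵥ v = 0 := by rw [hΓ, neg_mulVec, hker v hv, neg_zero]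
    rw [add_mulVec, ← mulVec_mulVec, hv, mulVec_zero, zero_add, ← mulVec_mulVec, hB, sub_mulVec,
      ← mulVec_mulVec, hker v hv, mulVec_zero, sub_zero] at h1
    exact h1
  -- `N = P⁻¹ - Γ` is positive definite because `B' N + N B = -P⁻¹ R P⁻¹`; conjugate it by `P`
  have hPi : P⁻¹ᵀ = P⁻¹ := hP.inv.posSemidef.transpose_eq
  have hlyap : -(B * P + P * Bᵀ) = R + P * S * P := by
    rw [hB, lyapunov_closedLoop (R := R) hS hPt, hF, neg_zero, add_zero]
  have hN : -(Bᵀ * (P⁻¹ - Γ) + (P⁻¹ - Γ) * Bᵀᵀ) = P⁻¹ * R * P⁻¹ := by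
    have e1 : -(Bᵀ * P⁻¹ + P⁻¹ * B) = P⁻¹ * (-(B * P + P * Bᵀ)) * P⁻¹ := by
      have : P⁻¹ * (-(B * P + P * Bᵀ)) * P⁻¹
        = -(P⁻¹ * B * (P * P⁻¹) + (P⁻¹ * P) * Bᵀ * P⁻¹) := by noncomm_ring
      rw [this, hP.mul_inv, hP.inv_mul, mul_one, one_mul, add_comm]
    have e2 : P⁻¹ * (P * S * P) * P⁻¹ = S := by
      have : P⁻¹ * (P * S * P) * P⁻¹ = (P⁻¹ * P) * S * (P * P⁻¹) := by noncomm_ring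
      rw [this, hP.mul_inv, hP.inv_mul, mul_one, one_mul]
    have e3 : -(Bᵀ * (P⁻¹ - Γ) + (P⁻¹ - Γ) * Bᵀᵀ)
        = -(Bᵀ * P⁻¹ + P⁻¹ * B) + (Bᵀ * Γ + Γ * B) := by
      rw [transpose_transpose]; noncomm_ring
    rw [e3, e1, hΓ, hlyap, mul_add, add_mul, e2, add_neg_cancel_right]
  have hNp : (P⁻¹ - Γ).PosSemidef := hst.transpose.posSemidef
    (by rw [transpose_sub, hPi, hΓt]) (by
      rw [hN]; exact h.posDef.posSemidef.conj_symm hPi)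
  have hNd : (P⁻¹ - Γ).PosDef := by
    refine hNp.posDef_of_injective fun v hv =>
      (h.posDef.conj_posDef hP.inv).eq_zero_of_mulVec_eq_zero ?_
    refine (h.posDef.posSemidef.conj_symm hPi).mulVec_eq_zero ?_
    rw [← hN, transpose_transpose, neg_mulVec, dotProduct_neg, add_mulVec, dotProduct_add,
      ← mulVec_mulVec, hv, ← mulVec_mulVec, dotProduct_mulVec_comm (P⁻¹ - Γ), hNp.transpose_eq, hv]
    simp
  have hgap : (P - P * Γ * P).PosDef := by
    have e : P * (P⁻¹ - Γ) * P = P - P * Γ * P := by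
      rw [mul_sub, sub_mul, hP.mul_inv, one_mul]
    rw [← e]
    exact hNd.conj_posDef hP
  obtain ⟨c, hc, hcg⟩ := hgap.exists_lower_bound
  exact ⟨⟨P, Γ, c, h, hP, hF, hst, hΓd, hΓ, hc, hcg⟩⟩

namespace SteadyState

variable {r : ℕ} {A R S : Matrix (Fin r) (Fin r) ℝ} (s : SteadyState A R S)

/-- The propagator of the stationary closed-loop matrix `A - P S`. -/
noncomputable def closedLoop (t : ℝ) : Matrix (Fin r) (Fin r) ℝ := propagator (A - s.P * S) t

/-- The observability Gramian `∫₀ᵗ E(s)' S E(s) ds` of the closed-loop matrix, written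
without an integral as `Γ - E(t)' Γ E(t)`. -/
noncomputable def gram (t : ℝ) : Matrix (Fin r) (Fin r) ℝ :=
  s.Γ - (s.closedLoop t)ᵀ * s.Γ * s.closedLoop t

/-- The matrix `1 + (Q - P) G(t)` that is inverted in the explicit Riccati flow. -/
noncomputable def den (Q : Matrix (Fin r) (Fin r) ℝ) (t : ℝ) : Matrix (Fin r) (Fin r) ℝ :=
  1 + (Q - s.P) * s.gram t

/-- The transition matrix `E(t) (1 + (Q - P) G(t))⁻¹` along the Riccati flow started at `Q`. -/
noncomputable def trans (Q : Matrix (Fin r) (Fin r) ℝ) (t : ℝ) : Matrix (Fin r) (Fin r) ℝ :=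
  s.closedLoop t * (s.den Q t)⁻¹

/-- The Riccati flow in closed form: `P + E(t) (1 + (Q - P) G(t))⁻¹ (Q - P) E(t)'`. -/
noncomputable def sol (Q : Matrix (Fin r) (Fin r) ℝ) (t : ℝ) : Matrix (Fin r) (Fin r) ℝ :=
  s.P + s.trans Q t * (Q - s.P) * (s.closedLoop t)ᵀ

theorem P_transpose : s.Pᵀ = s.P := s.posDef.posSemidef.transpose_eq

theorem Γ_transpose : s.Γᵀ = s.Γ := s.gramian_posDef.posSemidef.transpose_eq

theorem gram_transpose (t : ℝ) : (s.gram t)ᵀ = s.gram t := by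
  simp only [gram, transpose_sub, transpose_mul, transpose_transpose, s.Γ_transpose,
    Matrix.mul_assoc]

theorem gram_zero : s.gram 0 = 0 := by
  simp [gram, closedLoop, propagator_zero]

theorem hasDerivWithinAt_gram (t : ℝ) (u : Set ℝ) :
    HasDerivWithinAt s.gram ((s.closedLoop t)ᵀ * S * s.closedLoop t) u t := by
  have h1 := hasDerivWithinAt_propagator_conj (A - s.P * S)ᵀ s.Γ u t
  simp only [propagator_transpose, transpose_transpose, s.gramian_eq] at h1
  refine (h1.const_sub s.Γ).congr_deriv ?_
  simp [closedLoop]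

theorem gram_posSemidef {t : ℝ} (ht : 0 ≤ t) : (s.gram t).PosSemidef := by
  refine posSemidef_iff_dotProduct.2 ⟨s.gram_transpose t, fun v => ?_⟩
  have hm := monotoneOn_Ici_of_hasDerivWithinAt
    (fun t _ => hasDerivWithinAt_quad (s.hasDerivWithinAt_gram t (Set.Ici 0)) v)
    (fun t _ => by
      have := (s.data.posSemidef.conj (s.closedLoop t)ᵀ).quad_nonneg v
      rwa [transpose_transpose] at this) (Set.mem_Ici.2 le_rfl) (Set.mem_Ici.2 ht) ht
  simpa only [gram_zero, zero_mulVec, dotProduct_zero] using hm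

theorem quad_gram_le (t : ℝ) (v : Fin r → ℝ) : v ⬝ᵥ s.gram t *ᵥ v ≤ v ⬝ᵥ s.Γ *ᵥ v := by
  have := (s.gramian_posDef.posSemidef.conj (s.closedLoop t)ᵀ).quad_nonneg v
  rw [transpose_transpose] at this
  rw [gram, sub_mulVec, dotProduct_sub]
  linarith

/-- The strict form of `G P G ≤ G` that follows from `G ≤ Γ < P⁻¹` by the Cauchy–Schwarz
inequality for `G`. -/
theorem quad_gram_ge {t : ℝ} (ht : 0 ≤ t) (w : Fin r → ℝ) :
    (s.gram t *ᵥ w) ⬝ᵥ s.P *ᵥ (s.gram t *ᵥ w) + s.c * ((s.gram t *ᵥ w) ⬝ᵥ (s.gram t *ᵥ w))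
      ≤ w ⬝ᵥ s.gram t *ᵥ w := by
  set u := s.gram t *ᵥ w with hu
  have hG := s.gram_posSemidef ht
  have h1 := hG.cauchySchwarz (s.P *ᵥ u) w
  have e1 : (s.P *ᵥ u) ⬝ᵥ s.gram t *ᵥ w = u ⬝ᵥ s.P *ᵥ u := by rw [← hu, dotProduct_comm]
  have h2 := s.quad_gram_le t (s.P *ᵥ u)
  have e2 : (s.P *ᵥ u) ⬝ᵥ s.Γ *ᵥ (s.P *ᵥ u) = u ⬝ᵥ (s.P * s.Γ * s.P) *ᵥ u := by
    have := quad_conj s.P s.Γ u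
    rw [s.P_transpose] at this
    exact this.symm
  have h3 := s.gap u
  rw [sub_mulVec, dotProduct_sub, ← e2] at h3
  rw [e1] at h1
  have h4 := hG.quad_nonneg w
  have h5 := s.posDef.posSemidef.quad_nonneg u
  have h6 := mul_nonneg s.c_pos.le (dotProduct_self_nonneg u)
  set a := u ⬝ᵥ s.P *ᵥ u
  set g := w ⬝ᵥ s.gram t *ᵥ w
  set e := s.c * (u ⬝ᵥ u)
  have h7 : a ^ 2 ≤ g * (a - e) := h1.trans (by
    rw [mul_comm]
    exact mul_le_mul_of_nonneg_left (by linarith) h4)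
  rcases le_or_gt (a - e) 0 with h8 | h8
  · have ha : a = 0 := by
      refine pow_eq_zero_iff two_ne_zero |>.1 (le_antisymm (h7.trans ?_) (sq_nonneg _))
      exact mul_nonpos_of_nonneg_of_nonpos h4 h8
    have hu0 : u = 0 := by
      by_contra h0
      exact (s.posDef.quad_pos h0).ne' ha
    have he : e = 0 := by simp [e, hu0]
    linarith
  · refine le_of_mul_le_mul_right ?_ h8
    nlinarith

/-- The a priori estimate behind the invertibility of `1 + (Q - P) G(t)`: the image under `G(t)` of
a solution `w` of `(1 + (Q - P) G(t)) w = y` is controlled by `y`, uniformly in `Q` and `t`. -/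
theorem gram_mulVec_le {Q : Matrix (Fin r) (Fin r) ℝ} (hQ : Q.PosSemidef) {t : ℝ} (ht : 0 ≤ t)
    (w : Fin r → ℝ) : (s.gram t *ᵥ w) ⬝ᵥ (s.gram t *ᵥ w)
      ≤ (1 / s.c) ^ 2 * ((s.den Q t *ᵥ w) ⬝ᵥ (s.den Q t *ᵥ w)) := by
  have h1 := s.quad_gram_ge ht w
  set u := s.gram t *ᵥ w with hu
  set y := s.den Q t *ᵥ w with hy
  have hy' : y = w + (Q *ᵥ u - s.P *ᵥ u) := by
    rw [hy, den, add_mulVec, one_mulVec, ← mulVec_mulVec, sub_mulVec]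
  have h2 : u ⬝ᵥ y = w ⬝ᵥ u + (u ⬝ᵥ Q *ᵥ u - u ⬝ᵥ s.P *ᵥ u) := by
    rw [hy', dotProduct_add, dotProduct_sub, dotProduct_comm u w]
  have h3 := hQ.quad_nonneg u
  have h4 := dotProduct_sq_le u y
  have h5 := dotProduct_self_nonneg u
  have h6 : s.c * (u ⬝ᵥ u) ≤ u ⬝ᵥ y := by linarith
  have h7 : (s.c * (u ⬝ᵥ u)) ^ 2 ≤ (u ⬝ᵥ u) * (y ⬝ᵥ y) :=
    (pow_le_pow_left₀ (mul_nonneg s.c_pos.le h5) h6 2).trans h4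
  have hc := s.c_pos
  rw [div_pow, one_pow, one_div, ← div_eq_inv_mul, le_div_iff₀ (by positivity)]
  rcases h5.eq_or_lt with h0 | h0
  · rw [← h0, zero_mul]; exact dotProduct_self_nonneg y
  · refine le_of_mul_le_mul_right ?_ h0
    nlinarith

theorem isUnit_den {Q : Matrix (Fin r) (Fin r) ℝ} (hQ : Q.PosSemidef) {t : ℝ} (ht : 0 ≤ t) :
    IsUnit (s.den Q t) := by
  refine isUnit_of_mulVec_injective fun v hv => ?_
  have h1 := s.gram_mulVec_le hQ ht v
  rw [hv, dotProduct_zero, mul_zero] at h1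
  have h2 : s.gram t *ᵥ v = 0 :=
    dotProduct_self_eq_zero.1 (le_antisymm h1 (dotProduct_self_nonneg _))
  rw [den, add_mulVec, ← mulVec_mulVec, h2, mulVec_zero, one_mulVec, add_zero] at hv
  exact hv

theorem norm_gram_mul_inv_le {Q : Matrix (Fin r) (Fin r) ℝ} (hQ : Q.PosSemidef) {t : ℝ}
    (ht : 0 ≤ t) : ‖s.gram t * (s.den Q t)⁻¹‖ ≤ 1 / s.c := by
  refine norm_le_of_dotProduct_le _ (one_div_nonneg.2 s.c_pos.le) fun v => ?_
  have := s.gram_mulVec_le hQ ht ((s.den Q t)⁻¹ *ᵥ v)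
  rwa [mulVec_mulVec, mulVec_mulVec, (s.isUnit_den hQ ht).matrix_mul_inv, one_mulVec] at this

theorem norm_den_inv_le {Q : Matrix (Fin r) (Fin r) ℝ} (hQ : Q.PosSemidef) {t : ℝ} (ht : 0 ≤ t) :
    ‖(s.den Q t)⁻¹‖ ≤ 1 + (‖Q‖ + ‖s.P‖) / s.c := by
  have h1 : (s.den Q t)⁻¹ = 1 - (Q - s.P) * (s.gram t * (s.den Q t)⁻¹) := by
    have := (s.isUnit_den hQ ht).matrix_mul_inv
    nth_rewrite 1 [den] at this
    rw [add_mul, one_mul, Matrix.mul_assoc] at this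
    exact eq_sub_of_add_eq this
  rw [h1]
  refine (norm_sub_le _ _).trans (add_le_add (norm_one_le r) ?_)
  rw [div_eq_mul_one_div]
  exact (norm_mul_le _ _).trans (mul_le_mul (norm_sub_le _ _) (s.norm_gram_mul_inv_le hQ ht)
    (norm_nonneg _) (by positivity))

theorem isUnit_trans {Q : Matrix (Fin r) (Fin r) ℝ} (hQ : Q.PosSemidef) {t : ℝ} (ht : 0 ≤ t) :
    IsUnit (s.trans Q t) :=
  (isUnit_propagator _ t).mul ((Matrix.isUnit_nonsing_inv_iff).2 (s.isUnit_den hQ ht))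

theorem trans_zero (Q : Matrix (Fin r) (Fin r) ℝ) : s.trans Q 0 = 1 := by
  simp [trans, closedLoop, propagator_zero, den, gram_zero]

theorem sol_zero (Q : Matrix (Fin r) (Fin r) ℝ) : s.sol Q 0 = Q := by
  simp [sol, trans_zero, closedLoop, propagator_zero]

theorem trans_mul_den {Q : Matrix (Fin r) (Fin r) ℝ} (hQ : Q.PosSemidef) {t : ℝ} (ht : 0 ≤ t) :
    s.trans Q t * s.den Q t = s.closedLoop t := by
  rw [trans, Matrix.mul_assoc, (s.isUnit_den hQ ht).matrix_inv_mul, mul_one]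

theorem sol_transpose {Q : Matrix (Fin r) (Fin r) ℝ} (hQ : Q.PosSemidef) {t : ℝ} (ht : 0 ≤ t) :
    (s.sol Q t)ᵀ = s.sol Q t := by
  have h1 := s.trans_mul_den hQ ht
  have h2 : s.den Q t * (Q - s.P) = (Q - s.P) * (s.den Q t)ᵀ := by
    simp only [den, transpose_add, transpose_mul, transpose_sub, transpose_one, s.gram_transpose,
      hQ.transpose_eq, s.P_transpose]
    noncomm_ring
  have h3 : s.trans Q t * (Q - s.P) * (s.closedLoop t)ᵀ
      = s.trans Q t * (s.den Q t * (Q - s.P)) * (s.trans Q t)ᵀ := by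
    rw [h2, ← h1, transpose_mul]
    simp only [Matrix.mul_assoc]
  rw [sol, transpose_add, s.P_transpose, transpose_mul, transpose_mul, transpose_transpose,
    transpose_sub, hQ.transpose_eq, s.P_transpose, h3, ← Matrix.mul_assoc, ← Matrix.mul_assoc, h1]

theorem hasDerivWithinAt_trans {Q : Matrix (Fin r) (Fin r) ℝ} (hQ : Q.PosSemidef) {t : ℝ}
    (ht : 0 ≤ t) :
    HasDerivWithinAt (s.trans Q) ((A - s.sol Q t * S) * s.trans Q t) (Set.Ici 0) t := by
  have h1 := (hasDerivAt_propagator' (A - s.P * S) t).hasDerivWithinAt (s := Set.Ici 0)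
  have h2 := ((s.hasDerivWithinAt_gram t (Set.Ici 0)).const_mul (Q - s.P)).const_add 1
  have h3 := h1.mul (hasDerivWithinAt_matrix_inv h2 (s.isUnit_den hQ ht))
  refine h3.congr_deriv ?_
  change (A - s.P * S) * s.closedLoop t * (s.den Q t)⁻¹ + s.closedLoop t *
    -((s.den Q t)⁻¹ * ((Q - s.P) * ((s.closedLoop t)ᵀ * S * s.closedLoop t)) * (s.den Q t)⁻¹) = _
  rw [sol, trans]
  noncomm_ring

/-- The Riccati drift at a displacement `X` from the stationary point, as a Sylvester form: `X` is
multiplied on the left by the closed-loop matrix at `P + X` and on the right by the one at `P`. -/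
theorem riccatiDrift_add (X : Matrix (Fin r) (Fin r) ℝ) :
    riccatiDrift A R S (s.P + X) = (A - (s.P + X) * S) * X + X * (A - s.P * S)ᵀ := by
  have h1 : riccatiDrift A R S (s.P + X)
      = riccatiDrift A R S s.P + ((A - (s.P + X) * S) * X + X * (A - s.P * S)ᵀ) := by
    simp only [riccatiDrift, transpose_sub, transpose_mul, s.data.posSemidef.transpose_eq,
      s.P_transpose]
    noncomm_ring
  rw [h1, s.drift_eq, zero_add]

theorem hasDerivWithinAt_sol {Q : Matrix (Fin r) (Fin r) ℝ} (hQ : Q.PosSemidef) {t : ℝ}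
    (ht : 0 ≤ t) :
    HasDerivWithinAt (s.sol Q) (riccatiDrift A R S (s.sol Q t)) (Set.Ici 0) t := by
  have h1 := hasDerivWithinAt_transpose
    ((hasDerivAt_propagator' (A - s.P * S) t).hasDerivWithinAt (s := Set.Ici 0))
  have h2 := (((s.hasDerivWithinAt_trans hQ ht).mul_const (Q - s.P)).mul h1).const_add s.P
  refine h2.congr_deriv ?_
  rw [sol, s.riccatiDrift_add]
  simp only [closedLoop, transpose_mul, Matrix.mul_assoc]

/-- The exact difference formula for the Riccati flow. -/
theorem sol_sub_sol {Q₁ Q₂ : Matrix (Fin r) (Fin r) ℝ} (h₁ : Q₁.PosSemidef) (h₂ : Q₂.PosSemidef)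
    {t : ℝ} (ht : 0 ≤ t) :
    s.sol Q₂ t - s.sol Q₁ t = s.trans Q₂ t * (Q₂ - Q₁) * (s.trans Q₁ t)ᵀ := by
  rw [← s.sol_transpose h₁ ht]
  simp only [sol, transpose_add, s.P_transpose, transpose_mul, transpose_transpose, transpose_sub,
    h₁.transpose_eq]
  have e1 : (s.closedLoop t)ᵀ = (s.den Q₁ t)ᵀ * (s.trans Q₁ t)ᵀ := by
    rw [← transpose_mul, s.trans_mul_den h₁ ht]
  rw [e1]
  rw [← s.trans_mul_den h₂ ht]
  simp only [den, transpose_add, transpose_mul, transpose_sub, transpose_one, s.gram_transpose,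
      h₁.transpose_eq, s.P_transpose]
  noncomm_ring

theorem trans_sub_trans {Q₁ Q₂ : Matrix (Fin r) (Fin r) ℝ} (h₁ : Q₁.PosSemidef)
    (h₂ : Q₂.PosSemidef) {t : ℝ} (ht : 0 ≤ t) :
    s.trans Q₂ t - s.trans Q₁ t
      = -(s.trans Q₂ t * (Q₂ - Q₁) * (s.gram t * (s.den Q₁ t)⁻¹)) := by
  have h3 : s.trans Q₁ t = s.trans Q₂ t * s.den Q₂ t * (s.den Q₁ t)⁻¹ := by
    rw [s.trans_mul_den h₂ ht, trans]
  have h4 : s.trans Q₂ t = s.trans Q₂ t * (s.den Q₁ t * (s.den Q₁ t)⁻¹) := by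
    rw [(s.isUnit_den h₁ ht).matrix_mul_inv, mul_one]
  rw [h3]
  nth_rewrite 1 [h4]
  generalize (s.den Q₁ t)⁻¹ = D
  simp only [den]
  noncomm_ring

theorem exists_norm_trans_le : ∃ K ν : ℝ, 0 < K ∧ 0 < ν ∧ ∀ Q : Matrix (Fin r) (Fin r) ℝ,
    Q.PosSemidef → ∀ t, 0 ≤ t →
      ‖s.trans Q t‖ ≤ K * (1 + (‖Q‖ + ‖s.P‖) / s.c) * Real.exp (-(2 * ν * t)) := by
  obtain ⟨K, ν, hK, hν, hE⟩ := s.stable.exists_norm_propagator_le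
  refine ⟨K, ν, hK, hν, fun Q hQ t ht => ?_⟩
  calc ‖s.trans Q t‖ ≤ ‖s.closedLoop t‖ * ‖(s.den Q t)⁻¹‖ := norm_mul_le _ _
    _ ≤ (K * Real.exp (-(2 * ν * t))) * (1 + (‖Q‖ + ‖s.P‖) / s.c) :=
      mul_le_mul (hE t ht) (s.norm_den_inv_le hQ ht) (norm_nonneg _) (by positivity)
    _ = _ := by ring

theorem tendsto_gram : Filter.Tendsto s.gram Filter.atTop (nhds s.Γ) := by
  have h1 := s.stable.transpose.tendsto_conj s.Γ
  simp only [propagator_transpose, transpose_transpose] at h1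
  have h2 := h1.const_sub s.Γ
  rw [sub_zero] at h2
  exact h2

/-- For large times the Riccati flow is bounded uniformly in the initial value: this
is the effect of observability, which makes the Gramian `G(t)` invertible. -/
theorem exists_uniform_bound : ∃ t₀ b : ℝ, 0 ≤ t₀ ∧ 0 ≤ b ∧ ∀ Q : Matrix (Fin r) (Fin r) ℝ,
    Q.PosSemidef → ∀ t, t₀ ≤ t → ‖s.sol Q t‖ ≤ b := by
  have hΓu := s.gramian_posDef.isUnit
  have hinv : Filter.Tendsto (fun t => (s.gram t)⁻¹) Filter.atTop (nhds s.Γ⁻¹) := by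
    simp only [Matrix.nonsing_inv_eq_ringInverse]
    obtain ⟨u, hu⟩ := hΓu
    have := NormedRing.inverse_continuousAt u
    rw [hu] at this
    exact this.tendsto.comp s.tendsto_gram
  have hunit : ∀ᶠ t in Filter.atTop, IsUnit (s.gram t) :=
    s.tendsto_gram.eventually (Units.isOpen.mem_nhds hΓu)
  have hE : Filter.Tendsto s.closedLoop Filter.atTop (nhds 0) := s.stable.tendsto_propagator
  have hlim : Filter.Tendsto (fun t => ‖s.P‖ + ‖s.closedLoop t‖ *
      (‖(s.gram t)⁻¹‖ * (‖s.gram t‖ + 1 / s.c) * ‖(s.gram t)⁻¹‖) * ‖s.closedLoop t‖) Filter.atTop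
      (nhds (‖s.P‖ + ‖(0 : Matrix (Fin r) (Fin r) ℝ)‖ *
        (‖s.Γ⁻¹‖ * (‖s.Γ‖ + 1 / s.c) * ‖s.Γ⁻¹‖) * ‖(0 : Matrix (Fin r) (Fin r) ℝ)‖)) :=
    (((hE.norm.mul ((hinv.norm.mul (s.tendsto_gram.norm.add_const _)).mul hinv.norm)).mul
      hE.norm).const_add _)
  rw [norm_zero, zero_mul, zero_mul, add_zero] at hlim
  have hev := hlim.eventually (gt_mem_nhds (lt_add_one ‖s.P‖))
  obtain ⟨t₀, ht₀⟩ := Filter.eventually_atTop.1 (hunit.and hev)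
  refine ⟨max t₀ 0, ‖s.P‖ + 1, le_max_right _ _, by positivity, fun Q hQ t ht => ?_⟩
  have ht0 : 0 ≤ t := (le_max_right _ _).trans ht
  obtain ⟨hu, hb⟩ := ht₀ t ((le_max_left _ _).trans ht)
  refine le_trans ?_ hb.le
  -- `G M⁻¹ Δ G = G - G M⁻¹` for `M = 1 + Δ G`
  have h1 : (s.den Q t)⁻¹ * (Q - s.P)
      = (s.gram t)⁻¹ * (s.gram t - s.gram t * (s.den Q t)⁻¹) * (s.gram t)⁻¹ := by
    have e1 : s.gram t - s.gram t * (s.den Q t)⁻¹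
        = s.gram t * ((s.den Q t)⁻¹ * (s.den Q t - 1)) := by
      rw [mul_sub, (s.isUnit_den hQ ht0).matrix_inv_mul, mul_sub, mul_one, mul_one]
    have e2 : s.den Q t - 1 = (Q - s.P) * s.gram t := by rw [den, add_sub_cancel_left]
    have e3 : (s.gram t)⁻¹ * (s.gram t * ((s.den Q t)⁻¹ * ((Q - s.P) * s.gram t))) * (s.gram t)⁻¹
      = ((s.gram t)⁻¹ * s.gram t) * ((s.den Q t)⁻¹ * (Q - s.P)) * (s.gram t * (s.gram t)⁻¹) := by
      simp only [Matrix.mul_assoc]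
    rw [e1, e2, e3, hu.matrix_inv_mul, hu.matrix_mul_inv, one_mul, mul_one]
  rw [sol, trans, Matrix.mul_assoc (s.closedLoop t), h1]
  refine (norm_add_le _ _).trans (add_le_add_right ?_ _)
  refine (norm_mul_le _ _).trans ?_
  rw [l2_opNorm_transpose]
  refine mul_le_mul_of_nonneg_right ?_ (norm_nonneg _)
  refine (norm_mul_le _ _).trans (mul_le_mul_of_nonneg_left ?_ (norm_nonneg _))
  refine (norm_mul_le _ _).trans (mul_le_mul_of_nonneg_right ?_ (norm_nonneg _))
  refine (norm_mul_le _ _).trans (mul_le_mul_of_nonneg_left ?_ (norm_nonneg _))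
  exact (norm_sub_le _ _).trans (add_le_add_right (s.norm_gram_mul_inv_le hQ ht0) _)

end SteadyState

/-! ### Comparison, well-posedness and perturbation -/

/-- Comparison principle: a symmetric solution of the Lyapunov equation `W' = L W + W L' + N` with
positive semidefinite source `N` and initial value stays positive semidefinite. Conjugation
by the transition matrix `U` of `L` turns `W` into a monotone path. -/
theorem posSemidef_of_lyapunov_source {n : ℕ} {L N U W : ℝ → Matrix (Fin n) (Fin n) ℝ}
    (hU : ∀ t, 0 ≤ t → HasDerivWithinAt U (L t * U t) (Set.Ici 0) t)
    (hUu : ∀ t, 0 ≤ t → IsUnit (U t))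
    (hW : ∀ t, 0 ≤ t → HasDerivWithinAt W (L t * W t + W t * (L t)ᵀ + N t) (Set.Ici 0) t)
    (hN : ∀ t, 0 ≤ t → (N t).PosSemidef) (hWt : ∀ t, 0 ≤ t → (W t)ᵀ = W t)
    (h0 : (W 0).PosSemidef) {t : ℝ} (ht : 0 ≤ t) : (W t).PosSemidef := by
  have hV : ∀ t, 0 ≤ t → HasDerivWithinAt (fun t => (U t)⁻¹ * W t * ((U t)⁻¹)ᵀ)
      ((U t)⁻¹ * N t * ((U t)⁻¹)ᵀ) (Set.Ici 0) t := by
    intro t ht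
    have h1 := hasDerivWithinAt_matrix_inv (hU t ht) (hUu t ht)
    have e : -((U t)⁻¹ * (L t * U t) * (U t)⁻¹) = -((U t)⁻¹ * L t) := by
      rw [Matrix.mul_assoc, Matrix.mul_assoc, (hUu t ht).matrix_mul_inv, mul_one]
    rw [e] at h1
    refine ((h1.mul (hW t ht)).mul (hasDerivWithinAt_transpose h1)).congr_deriv ?_
    simp only [Pi.mul_apply, transpose_neg, transpose_mul]
    noncomm_ring
  have hVp : ((U t)⁻¹ * W t * ((U t)⁻¹)ᵀ).PosSemidef := by
    refine posSemidef_iff_dotProduct.2 ⟨?_, fun v => ?_⟩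
    · rw [transpose_mul, transpose_mul, transpose_transpose, hWt t ht, Matrix.mul_assoc]
    · have hm := monotoneOn_Ici_of_hasDerivWithinAt
        (fun t ht => hasDerivWithinAt_quad (hV t ht) v)
        (fun t ht => ((hN t ht).conj _).quad_nonneg v)
        (Set.mem_Ici.2 le_rfl) (Set.mem_Ici.2 ht) ht
      exact ((h0.conj _).quad_nonneg v).trans hm
  have e : W t = U t * ((U t)⁻¹ * W t * ((U t)⁻¹)ᵀ) * (U t)ᵀ := by
    have : U t * ((U t)⁻¹ * W t * ((U t)⁻¹)ᵀ) * (U t)ᵀ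
        = (U t * (U t)⁻¹) * W t * (U t * (U t)⁻¹)ᵀ := by
      rw [transpose_mul]; simp only [Matrix.mul_assoc]
    rw [this, (hUu t ht).matrix_mul_inv, one_mul, transpose_one, mul_one]
  rw [e]
  exact hVp.conj _

theorem contDiff_riccatiDrift {r : ℕ} (A R S : Matrix (Fin r) (Fin r) ℝ) :
    ContDiff ℝ 1 (riccatiDrift A R S) := by
  unfold riccatiDrift
  fun_prop

/-- Solutions of the Riccati equation in the cone are unique, since the drift is Lipschitz on
bounded sets. -/
theorem IsCovarianceSolution.unique {r : ℕ} {A R S Q : Matrix (Fin r) (Fin r) ℝ}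
    {X Y : ℝ → Matrix (Fin r) (Fin r) ℝ} (hX : IsCovarianceSolution (riccatiDrift A R S) Q X)
    (hY : IsCovarianceSolution (riccatiDrift A R S) Q Y) {t : ℝ} (ht : 0 ≤ t) : X t = Y t := by
  have hcX : ContinuousOn X (Set.Icc 0 t) := fun u hu =>
    (hX.deriv u hu.1).continuousWithinAt.mono Set.Icc_subset_Ici_self
  have hcY : ContinuousOn Y (Set.Icc 0 t) := fun u hu =>
    (hY.deriv u hu.1).continuousWithinAt.mono Set.Icc_subset_Ici_self
  obtain ⟨a, ha⟩ := isCompact_Icc.exists_bound_of_continuousOn hcX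
  obtain ⟨b, hb⟩ := isCompact_Icc.exists_bound_of_continuousOn hcY
  obtain ⟨K, hK⟩ := (contDiff_riccatiDrift A R S).contDiffOn.exists_lipschitzOnWith one_ne_zero
    (convex_closedBall (0 : Matrix (Fin r) (Fin r) ℝ) (max a b)) (isCompact_closedBall _ _)
  refine ODE_solution_unique_of_mem_Icc_right (v := fun _ => riccatiDrift A R S)
    (s := fun _ => Metric.closedBall 0 (max a b)) (K := K) (fun _ _ => hK) hcX
    (fun u hu => (hX.deriv u hu.1).mono (Set.Ici_subset_Ici.2 hu.1))
    (fun u hu => mem_closedBall_zero_iff.2 ((ha u ⟨hu.1, hu.2.le⟩).trans (le_max_left _ _))) hcY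
    (fun u hu => (hY.deriv u hu.1).mono (Set.Ici_subset_Ici.2 hu.1))
    (fun u hu => mem_closedBall_zero_iff.2 ((hb u ⟨hu.1, hu.2.le⟩).trans (le_max_right _ _)))
    (hX.init.trans hY.init.symm) ⟨ht, le_rfl⟩

theorem IsWellPosed.flow_eq {r : ℕ} {F : Matrix (Fin r) (Fin r) ℝ → Matrix (Fin r) (Fin r) ℝ}
    (hF : IsWellPosed F) {Q : Matrix (Fin r) (Fin r) ℝ} (hQ : Q.PosSemidef)
    {X : ℝ → Matrix (Fin r) (Fin r) ℝ} (hX : IsCovarianceSolution F Q X) {t : ℝ} (ht : 0 ≤ t) :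
    flow F t Q = X t := by
  obtain ⟨P, -, hu⟩ := hF Q hQ
  have h : ∃ P, IsCovarianceSolution F Q P := ⟨X, hX⟩
  rw [flow, dif_pos h, hu _ h.choose_spec t ht, hu X hX t ht]

/-- Two drifts that agree on the cone have the same solutions in the cone. -/
theorem isCovarianceSolution_congr {r : ℕ}
    {F F' : Matrix (Fin r) (Fin r) ℝ → Matrix (Fin r) (Fin r) ℝ}
    (h : ∀ Q : Matrix (Fin r) (Fin r) ℝ, Q.PosSemidef → F Q = F' Q) :
    IsCovarianceSolution F = IsCovarianceSolution F' := by
  ext Q X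
  constructor
  · intro hX
    exact ⟨hX.init, hX.posSemidef, fun t ht => by
      rw [← h _ (hX.posSemidef t ht)]; exact hX.deriv t ht⟩
  · intro hX
    exact ⟨hX.init, hX.posSemidef, fun t ht => by
      rw [h _ (hX.posSemidef t ht)]; exact hX.deriv t ht⟩

theorem flow_congr {r : ℕ} {F F' : Matrix (Fin r) (Fin r) ℝ → Matrix (Fin r) (Fin r) ℝ}
    (h : ∀ Q : Matrix (Fin r) (Fin r) ℝ, Q.PosSemidef → F Q = F' Q) : flow F = flow F' := by
  funext t Q
  unfold flow
  rw [isCovarianceSolution_congr h]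

theorem isWellPosed_congr {r : ℕ} {F F' : Matrix (Fin r) (Fin r) ℝ → Matrix (Fin r) (Fin r) ℝ}
    (h : ∀ Q : Matrix (Fin r) (Fin r) ℝ, Q.PosSemidef → F Q = F' Q) :
    IsWellPosed F ↔ IsWellPosed F' := by
  simp only [IsWellPosed, isCovarianceSolution_congr h]

theorem hasUniqueFixedPoint_congr {r : ℕ}
    {F F' : Matrix (Fin r) (Fin r) ℝ → Matrix (Fin r) (Fin r) ℝ}
    (h : ∀ Q : Matrix (Fin r) (Fin r) ℝ, Q.PosSemidef → F Q = F' Q) (hF' : HasUniqueFixedPoint F') :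
    HasUniqueFixedPoint F := by
  obtain ⟨P, hP, h0, hu⟩ := hF'
  refine ⟨P, hP, (h P hP.posSemidef).trans h0, fun P' => ?_⟩
  rw [← hu P', IsFixedPoint, IsFixedPoint, flow_congr h]

namespace SteadyState

variable {r : ℕ} {A R S : Matrix (Fin r) (Fin r) ℝ} (s : SteadyState A R S)

theorem sol_posSemidef {Q : Matrix (Fin r) (Fin r) ℝ} (hQ : Q.PosSemidef) {t : ℝ} (ht : 0 ≤ t) :
    (s.sol Q t).PosSemidef := by
  refine posSemidef_of_lyapunov_source (U := s.trans Q) (L := fun t => A - s.sol Q t * S)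
    (N := fun t => s.sol Q t * S * s.sol Q t + R) (fun t ht => s.hasDerivWithinAt_trans hQ ht)
    (fun t ht => s.isUnit_trans hQ ht) (fun t ht => ?_) (fun t ht => ?_)
    (fun t ht => s.sol_transpose hQ ht) (by rwa [s.sol_zero]) ht
  · refine (s.hasDerivWithinAt_sol hQ ht).congr_deriv ?_
    simp only [riccatiDrift, transpose_sub, transpose_mul, s.data.posSemidef.transpose_eq,
      s.sol_transpose hQ ht]
    noncomm_ring
  · exact (s.data.posSemidef.conj_symm (s.sol_transpose hQ ht)).add s.data.posDef.posSemidef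

theorem isCovarianceSolution {Q : Matrix (Fin r) (Fin r) ℝ} (hQ : Q.PosSemidef) :
    IsCovarianceSolution (riccatiDrift A R S) Q (s.sol Q) :=
  ⟨s.sol_zero Q, fun _ ht => s.sol_posSemidef hQ ht, fun _ ht => s.hasDerivWithinAt_sol hQ ht⟩

theorem isWellPosed (s : SteadyState A R S) : IsWellPosed (riccatiDrift A R S) := fun Q hQ =>
  ⟨s.sol Q, s.isCovarianceSolution hQ, fun _ hX _ ht => hX.unique (s.isCovarianceSolution hQ) ht⟩

theorem flow_eq {Q : Matrix (Fin r) (Fin r) ℝ} (hQ : Q.PosSemidef) {t : ℝ} (ht : 0 ≤ t) :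
    flow (riccatiDrift A R S) t Q = s.sol Q t :=
  s.isWellPosed.flow_eq hQ (s.isCovarianceSolution hQ) ht

theorem tendsto_sol {Q : Matrix (Fin r) (Fin r) ℝ} (hQ : Q.PosSemidef) :
    Filter.Tendsto (s.sol Q) Filter.atTop (nhds s.P) := by
  obtain ⟨K, ν, hK, hν, hT⟩ := s.exists_norm_trans_le
  have h1 : Filter.Tendsto (fun t : ℝ => Real.exp (-(2 * ν * t))) Filter.atTop (nhds 0) :=
    Real.tendsto_exp_neg_atTop_nhds_zero.comp
      (Filter.tendsto_id.const_mul_atTop (by positivity))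
  have h2 : Filter.Tendsto (s.trans Q) Filter.atTop (nhds 0) := by
    refine squeeze_zero_norm' (Filter.eventually_atTop.2 ⟨0, fun t ht => hT Q hQ t ht⟩) ?_
    simpa using h1.const_mul (K * (1 + (‖Q‖ + ‖s.P‖) / s.c))
  have h3 := s.stable.transpose.tendsto_propagator
  simp only [funext (propagator_transpose (A - s.P * S))] at h3
  have h4 := ((h2.mul_const (Q - s.P)).mul h3).const_add s.P
  rw [zero_mul, zero_mul, add_zero] at h4
  exact h4

theorem sol_P (t : ℝ) : s.sol s.P t = s.P := by
  rw [sol, sub_self, mul_zero, zero_mul, add_zero]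

theorem isFixedPoint_iff {P' : Matrix (Fin r) (Fin r) ℝ} :
    IsFixedPoint (riccatiDrift A R S) P' ↔ P' = s.P := by
  constructor
  · rintro ⟨hP', hfix⟩
    refine tendsto_nhds_unique (tendsto_const_nhds.congr' ?_) (s.tendsto_sol hP')
    filter_upwards [Filter.eventually_ge_atTop 0] with t ht
    rw [← s.flow_eq hP' ht, hfix t ht]
  · rintro rfl
    exact ⟨s.posDef.posSemidef, fun t ht => by rw [s.flow_eq s.posDef.posSemidef ht, s.sol_P]⟩

theorem hasUniqueFixedPoint (s : SteadyState A R S) :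
    HasUniqueFixedPoint (riccatiDrift A R S) :=
  ⟨s.P, s.posDef, s.drift_eq, fun _ => s.isFixedPoint_iff⟩

/-- The closed forms of the flow and of its transition matrices give a contraction rate. -/
theorem exists_isContractionRate (s : SteadyState A R S) : ∃ ν, IsContractionRate A R S ν := by
  obtain ⟨K, ν, hK, hν, hT⟩ := s.exists_norm_trans_le
  have hc := s.c_pos
  -- truncation at `0` makes the bounds monotone on all of `ℝ`
  set κ : ℝ → ℝ := fun x => K * (1 + (max x 0 + ‖s.P‖) / s.c) with hκ
  have hκm : Monotone κ := by
    intro x y hxy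
    simp only [hκ]
    gcongr
  have hκ0 : ∀ x, 0 ≤ κ x := fun x => by
    have := le_max_right x 0
    simp only [hκ]
    positivity
  have hT' : ∀ Q : Matrix (Fin r) (Fin r) ℝ, Q.PosSemidef → ∀ t, 0 ≤ t →
      ‖s.trans Q t‖ ≤ κ ‖Q‖ * Real.exp (-(2 * ν * t)) := by
    intro Q hQ t ht
    simpa only [hκ, max_eq_left (norm_nonneg Q)] using hT Q hQ t ht
  refine ⟨ν, hν, s.trans, fun Q hQ => ⟨s.trans_zero Q, fun t ht => ?_⟩, κ,
    fun p => κ p.1 * κ p.2, fun p => κ p.2 * (1 / s.c), hκm, ?_, ?_, hT', ?_, ?_⟩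
  · rw [s.flow_eq hQ ht]
    exact s.hasDerivWithinAt_trans hQ ht
  · intro p q hpq
    exact mul_le_mul (hκm hpq.1) (hκm hpq.2) (hκ0 _) (hκ0 _)
  · intro p q hpq
    exact mul_le_mul_of_nonneg_right (hκm hpq.2) (by positivity)
  · intro Q₁ Q₂ h₁ h₂ t ht
    rw [s.flow_eq h₁ ht, s.flow_eq h₂ ht, s.sol_sub_sol h₁ h₂ ht]
    have he : Real.exp (-(2 * ν * t)) ≤ 1 := Real.exp_le_one_iff.2 (by
      have : 0 ≤ 2 * ν * t := by positivity
      linarith)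
    calc ‖s.trans Q₂ t * (Q₂ - Q₁) * (s.trans Q₁ t)ᵀ‖
        ≤ ‖s.trans Q₂ t‖ * ‖Q₂ - Q₁‖ * ‖s.trans Q₁ t‖ := by
          rw [← l2_opNorm_transpose (s.trans Q₁ t)]
          exact (norm_mul_le _ _).trans
            (mul_le_mul_of_nonneg_right (norm_mul_le _ _) (norm_nonneg _))
      _ ≤ (κ ‖Q₂‖ * 1) * ‖Q₂ - Q₁‖ * (κ ‖Q₁‖ * Real.exp (-(2 * ν * t))) := by
          have h3 := (hT' Q₂ h₂ t ht).trans (mul_le_mul_of_nonneg_left he (hκ0 _))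
          have h4 := hT' Q₁ h₁ t ht
          have h5 := hκ0 ‖Q₂‖
          gcongr
      _ = _ := by ring
  · intro Q₁ Q₂ h₁ h₂ t ht
    rw [s.trans_sub_trans h₁ h₂ ht, norm_neg]
    have he : Real.exp (-(2 * ν * t)) ≤ Real.exp (-(ν * t)) := Real.exp_le_exp.2 (by
      have : 0 ≤ ν * t := by positivity
      linarith)
    calc ‖s.trans Q₂ t * (Q₂ - Q₁) * (s.gram t * (s.den Q₁ t)⁻¹)‖
        ≤ ‖s.trans Q₂ t‖ * ‖Q₂ - Q₁‖ * ‖s.gram t * (s.den Q₁ t)⁻¹‖ :=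
          (norm_mul_le _ _).trans (mul_le_mul_of_nonneg_right (norm_mul_le _ _) (norm_nonneg _))
      _ ≤ (κ ‖Q₂‖ * Real.exp (-(ν * t))) * ‖Q₂ - Q₁‖ * (1 / s.c) := by
          have h3 := (hT' Q₂ h₂ t ht).trans (mul_le_mul_of_nonneg_left he (hκ0 _))
          have h4 := s.norm_gram_mul_inv_le h₁ ht
          have h5 := hκ0 ‖Q₂‖
          gcongr
      _ = _ := by ring

/-- The flow is bounded on `[0, ∞)` in terms of the norm of the initial value. -/
theorem exists_bound : ∃ g : ℝ → ℝ, ∀ Q : Matrix (Fin r) (Fin r) ℝ, Q.PosSemidef →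
    ∀ t, 0 ≤ t → ‖s.sol Q t‖ ≤ g ‖Q‖ := by
  obtain ⟨K, ν, hK, hν, hT⟩ := s.exists_norm_trans_le
  have hc := s.c_pos
  have hT' : ∀ Q : Matrix (Fin r) (Fin r) ℝ, Q.PosSemidef → ∀ t, 0 ≤ t →
      ‖s.trans Q t‖ ≤ K * (1 + (‖Q‖ + ‖s.P‖) / s.c) := by
    intro Q hQ t ht
    refine (hT Q hQ t ht).trans (mul_le_of_le_one_right (by positivity) ?_)
    have : 0 ≤ 2 * ν * t := by positivity
    exact Real.exp_le_one_iff.2 (by linarith)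
  refine ⟨fun q => ‖s.P‖ + K * (1 + (q + ‖s.P‖) / s.c) * (q + ‖s.P‖) *
    (K * (1 + (‖s.P‖ + ‖s.P‖) / s.c)), fun Q hQ t ht => ?_⟩
  have e : s.sol Q t = s.P + s.trans Q t * (Q - s.P) * (s.trans s.P t)ᵀ := by
    rw [← s.sol_sub_sol s.posDef.posSemidef hQ ht, s.sol_P, add_sub_cancel]
  rw [e]
  refine (norm_add_le _ _).trans (add_le_add_right ((norm_mul_le _ _).trans ?_) _)
  rw [l2_opNorm_transpose]
  refine mul_le_mul ((norm_mul_le _ _).trans ?_) (hT' s.P s.posDef.posSemidef t ht)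
    (norm_nonneg _) (by positivity)
  exact mul_le_mul (hT' Q hQ t ht) (norm_sub_le _ _) (norm_nonneg _) (by positivity)

/-- Increasing the observation term from `S` to `(1 + η) S` decreases the flow. -/
theorem sol_sub_sol_posSemidef {η : ℝ} (s' : SteadyState A R ((1 + η) • S)) (hη : 0 ≤ η)
    {Q : Matrix (Fin r) (Fin r) ℝ} (hQ : Q.PosSemidef) {t : ℝ} (ht : 0 ≤ t) :
    (s.sol Q t - s'.sol Q t).PosSemidef := by
  have hS := s.data.posSemidef.transpose_eq
  refine posSemidef_of_lyapunov_source (U := s.trans Q) (L := fun t => A - s.sol Q t * S)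
    (W := fun t => s.sol Q t - s'.sol Q t)
    (N := fun t => (s.sol Q t - s'.sol Q t) * S * (s.sol Q t - s'.sol Q t) +
      η • (s'.sol Q t * S * s'.sol Q t)) (fun t ht => s.hasDerivWithinAt_trans hQ ht)
    (fun t ht => s.isUnit_trans hQ ht) (fun t ht => ?_) (fun t ht => ?_)
    (fun t ht => ?_) ?_ ht
  · refine ((s.hasDerivWithinAt_sol hQ ht).sub (s'.hasDerivWithinAt_sol hQ ht)).congr_deriv ?_
    simp only [riccatiDrift, transpose_sub, transpose_mul, hS, s.sol_transpose hQ ht,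
      Matrix.mul_smul, Matrix.smul_mul, mul_sub, sub_mul, Matrix.mul_assoc]
    module
  · exact (s.data.posSemidef.conj_symm (by
      rw [transpose_sub, s.sol_transpose hQ ht, s'.sol_transpose hQ ht])).add
      ((s.data.posSemidef.conj_symm (s'.sol_transpose hQ ht)).smul hη)
  · rw [transpose_sub, s.sol_transpose hQ ht, s'.sol_transpose hQ ht]
  · rw [s.sol_zero, s'.sol_zero, sub_self]
    exact Matrix.PosSemidef.zero

/-- `(1 + η)` times the flow for `(1 + η) S` solves the Riccati equation for `S` with the larger
constant term `(1 + η) R`, so it dominates the flow for `S`. -/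
theorem smul_sol_sub_sol_posSemidef {η : ℝ} (s' : SteadyState A R ((1 + η) • S)) (hη : 0 ≤ η)
    {Q : Matrix (Fin r) (Fin r) ℝ} (hQ : Q.PosSemidef) {t : ℝ} (ht : 0 ≤ t) :
    ((1 + η) • s'.sol Q t - s.sol Q t).PosSemidef := by
  have hS := s.data.posSemidef.transpose_eq
  refine posSemidef_of_lyapunov_source (U := s'.trans Q)
    (L := fun t => A - s'.sol Q t * ((1 + η) • S))
    (W := fun t => (1 + η) • s'.sol Q t - s.sol Q t)
    (N := fun t => ((1 + η) • s'.sol Q t - s.sol Q t) * S * ((1 + η) • s'.sol Q t - s.sol Q t) +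
      η • R) (fun t ht => s'.hasDerivWithinAt_trans hQ ht)
    (fun t ht => s'.isUnit_trans hQ ht) (fun t ht => ?_) (fun t ht => ?_)
    (fun t ht => ?_) ?_ ht
  · refine (((s'.hasDerivWithinAt_sol hQ ht).const_smul (1 + η)).sub
      (s.hasDerivWithinAt_sol hQ ht)).congr_deriv ?_
    simp only [riccatiDrift, transpose_sub, transpose_mul, transpose_smul, hS,
      s'.sol_transpose hQ ht, Matrix.mul_smul, Matrix.smul_mul, mul_sub, sub_mul, Matrix.mul_assoc]
    module
  · exact (s.data.posSemidef.conj_symm (by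
      rw [transpose_sub, transpose_smul, s.sol_transpose hQ ht, s'.sol_transpose hQ ht])).add
      (s.data.posDef.posSemidef.smul hη)
  · rw [transpose_sub, transpose_smul, s.sol_transpose hQ ht, s'.sol_transpose hQ ht]
  · have : (1 + η) • s'.sol Q 0 - s.sol Q 0 = η • Q := by
      rw [s.sol_zero, s'.sol_zero]
      module
    rw [this]
    exact hQ.smul hη

/-- The perturbation estimate: the flows for `S` and `(1 + η) S` differ by at most `η` times
the size of the flow itself. -/
theorem norm_sol_sub_sol_le {η : ℝ} (s' : SteadyState A R ((1 + η) • S)) (hη : 0 ≤ η)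
    {Q : Matrix (Fin r) (Fin r) ℝ} (hQ : Q.PosSemidef) {t : ℝ} (ht : 0 ≤ t) :
    ‖s'.sol Q t - s.sol Q t‖ ≤ η * ‖s.sol Q t‖ := by
  rw [norm_sub_rev]
  have h1 := s.sol_sub_sol_posSemidef s' hη hQ ht
  refine h1.norm_le (by positivity) fun v => ?_
  have h2 := (s.smul_sol_sub_sol_posSemidef s' hη hQ ht).quad_nonneg v
  have h3 := h1.quad_nonneg v
  simp only [sub_mulVec, smul_mulVec, dotProduct_sub, dotProduct_smul, smul_eq_mul] at h2 h3 ⊢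
  have h4 := mul_le_mul_of_nonneg_left (dotProduct_mulVec_le_norm (s.sol Q t) v) hη
  have h5 := mul_le_mul_of_nonneg_left h3 hη
  linarith

end SteadyState

end KalmanRiccati

/-! ### The perturbation theorem -/

theorem corollary4p3 {r r' : ℕ}
    (A : Matrix (Fin r) (Fin r) ℝ) (C : Matrix (Fin r') (Fin r) ℝ)
    (R : Matrix (Fin r) (Fin r) ℝ) (Sig : Matrix (Fin r') (Fin r') ℝ)
    (hR : R.PosDef) (hSig : Sig.PosDef) (hobs : IsObservable A C)
    (S : Matrix (Fin r) (Fin r) ℝ) (hS : S = C.transpose * Sig⁻¹ * C) :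
    -- the semigroups `φ`, `φ_ε` and the fixed points `P`, `P_ε` are well defined
    (IsWellPosed (riccatiDrift A R S) ∧ HasUniqueFixedPoint (riccatiDrift A R S)) ∧
    (∀ ε₁ ∈ Set.Icc (0 : ℝ) 1, ∀ ε₂ ∈ Set.Icc (0 : ℝ) 1,
      (∀ Q : Matrix (Fin r) (Fin r) ℝ, Q.PosSemidef →
        perturbedDrift A R S ε₁ ε₂ Q = riccatiDrift A R ((1 + 2 * (ε₁ + ε₂)) • S) Q) ∧
      IsWellPosed (perturbedDrift A R S ε₁ ε₂) ∧
      HasUniqueFixedPoint (perturbedDrift A R S ε₁ ε₂)) ∧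
    -- a rate `ν` exists, and the estimates hold for every rate
    (∃ ν : ℝ, IsContractionRate A R S ν) ∧
    ∀ ν : ℝ, IsContractionRate A R S ν →
      ∃ δ : ℝ, 0 < δ ∧ δ ≤ 1 ∧ ∃ (χ₁ : ℝ) (χ₂ : ℝ → ℝ),
        ∀ ε₁ ∈ Set.Icc (0 : ℝ) δ, ∀ ε₂ ∈ Set.Icc (0 : ℝ) δ,
          (∀ t : ℝ, 0 ≤ t → ∀ Q : Matrix (Fin r) (Fin r) ℝ, Q.PosSemidef →
            ‖flow (perturbedDrift A R S ε₁ ε₂) t Q - flow (riccatiDrift A R S) t Q‖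
              ≤ 2 * (ε₁ + ε₂) * (χ₁ + Real.exp (-(4 * t * ν)) * χ₂ ‖Q‖)) ∧
          (∀ P Pε : Matrix (Fin r) (Fin r) ℝ,
            IsFixedPoint (riccatiDrift A R S) P →
            IsFixedPoint (perturbedDrift A R S ε₁ ε₂) Pε →
            ‖Pε - P‖ ≤ 2 * (ε₁ + ε₂) * χ₁) := by
  have hdata : RiccatiData A R S := hS ▸ riccatiData_of_isObservable hR hSig hobs
  obtain ⟨s⟩ := hdata.nonempty_steadyState
  have hpert : ∀ ε₁ ∈ Set.Icc (0 : ℝ) 1, ∀ ε₂ ∈ Set.Icc (0 : ℝ) 1,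
      (∀ Q : Matrix (Fin r) (Fin r) ℝ, Q.PosSemidef →
        perturbedDrift A R S ε₁ ε₂ Q = riccatiDrift A R ((1 + 2 * (ε₁ + ε₂)) • S) Q) ∧
      Nonempty (SteadyState A R ((1 + 2 * (ε₁ + ε₂)) • S)) := by
    intro ε₁ h₁ ε₂ h₂
    refine ⟨fun Q hQ => perturbedDrift_eq A R S ε₁ ε₂ hdata.posSemidef.transpose_eq Q
      hQ.transpose_eq, (hdata.smul ?_).nonempty_steadyState⟩
    linarith [h₁.1, h₂.1]
  refine ⟨⟨s.isWellPosed, s.hasUniqueFixedPoint⟩, fun ε₁ h₁ ε₂ h₂ => ?_,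
    s.exists_isContractionRate, fun ν hν => ?_⟩
  · obtain ⟨hd, ⟨s'⟩⟩ := hpert ε₁ h₁ ε₂ h₂
    exact ⟨hd, (isWellPosed_congr hd).2 s'.isWellPosed,
      hasUniqueFixedPoint_congr hd s'.hasUniqueFixedPoint⟩
  obtain ⟨t₀, b, ht₀, hb, hunif⟩ := s.exists_uniform_bound
  obtain ⟨g, hg⟩ := s.exists_bound
  have hν0 : 0 < ν := hν.1
  -- for `t ≤ t₀` the factor `exp (-4 t ν)` is at least `exp (-4 t₀ ν)`, which `χ₂` compensates
  refine ⟨1, one_pos, le_rfl, b, fun q => Real.exp (4 * t₀ * ν) * |g q|, fun ε₁ h₁ ε₂ h₂ => ?_⟩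
  obtain ⟨hd, ⟨s'⟩⟩ := hpert ε₁ h₁ ε₂ h₂
  have hη : 0 ≤ 2 * (ε₁ + ε₂) := by linarith [h₁.1, h₂.1]
  have hmain : ∀ t : ℝ, 0 ≤ t → ∀ Q : Matrix (Fin r) (Fin r) ℝ, Q.PosSemidef →
      ‖s'.sol Q t - s.sol Q t‖ ≤ 2 * (ε₁ + ε₂) *
        (b + Real.exp (-(4 * t * ν)) * (Real.exp (4 * t₀ * ν) * |g ‖Q‖|)) := by
    intro t ht Q hQ
    refine (s.norm_sol_sub_sol_le s' hη hQ ht).trans (mul_le_mul_of_nonneg_left ?_ hη)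
    rcases le_total t₀ t with h | h
    · exact (hunif Q hQ t h).trans (le_add_of_nonneg_right (by positivity))
    · rw [← mul_assoc, ← Real.exp_add]
      have he : 1 ≤ Real.exp (-(4 * t * ν) + 4 * t₀ * ν) := Real.one_le_exp (by nlinarith)
      calc ‖s.sol Q t‖ ≤ |g ‖Q‖| := (hg Q hQ t ht).trans (le_abs_self _)
        _ ≤ Real.exp (-(4 * t * ν) + 4 * t₀ * ν) * |g ‖Q‖| :=
          le_mul_of_one_le_left (abs_nonneg _) he
        _ ≤ _ := le_add_of_nonneg_left hb
  refine ⟨fun t ht Q hQ => ?_, fun P Pε hP hPε => ?_⟩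
  · rw [flow_congr hd, s'.flow_eq hQ ht, s.flow_eq hQ ht]
    exact hmain t ht Q hQ
  · rw [IsFixedPoint, flow_congr hd] at hPε
    have hP' : P = s.P := s.isFixedPoint_iff.1 hP
    have hPε' : Pε = s'.P := s'.isFixedPoint_iff.1 hPε
    -- the fixed points are the limits of the two flows started at `P`
    have h0 := s.posDef.posSemidef
    have hlim : Filter.Tendsto (fun t => ‖s'.sol s.P t - s.sol s.P t‖) Filter.atTop
        (nhds ‖s'.P - s.P‖) := ((s'.tendsto_sol h0).sub (s.tendsto_sol h0)).norm
    rw [hP', hPε']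
    refine le_of_tendsto hlim (Filter.eventually_atTop.2 ⟨t₀, fun t ht => ?_⟩)
    exact (s.norm_sol_sub_sol_le s' hη h0 (ht₀.trans ht)).trans
      (mul_le_mul_of_nonneg_left (hunif s.P h0 t ht) hη)
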